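/- Let $\Omega$ be a connected, paracompact (Hausdorff) complex analytic manifold of dimension $n\ge 1$ with basepoint $p$, and let $E$ be a complex Hilbert space with a conjugate linear isometric involution $f\mapsto f^\star$; put $f\cdot g=\langle f,g^\star\rangle_E$. For an $E$-valued analytic $n$-form $\alpha$ on $\Omega$, locally $\alpha=f\,dz_1\wedge\cdots\wedge dz_n$ with $f$ analytic, let $\alpha^\star=f^\star\,d\bar z_1\wedge\cdots\wedge d\bar z_n$ and $P_n=(-2i)^n(-1)^{n(n-1)/2}$. Then $\alpha\wedge\alpha^\star/P_n$ (values being multiplied by $f\cdot g$) is the volume measure equal to $\|f\|_E^2\,dx_1dy_1\cdots dx_ndy_n$ in local coordinates. Let $k:\Omega\to\mathbb R$ be an admissible weight: $k$ is Lebesgue measurable, and each $a\in\Omega$ has a connected open coordinate neighborhood on which $k>\varepsilon$ a.e. for some constant $\varepsilon>0$. Let $A^2(E,\Omega,k)$ be the space of all $E$-valued analytic $n$-forms $\alpha$ on $\Omega$ with $$\|\alpha\|^2=\int_\Omega k\,\alpha\wedge\alpha^\star/P_n<\infty .$$ Let $R=H^\infty(\Omega)$ be the algebra of bounded complex valued analytic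 functions on $\Omega$ or, when $\Omega$ is a bounded domain in $\mathbb C^n$, let $R$ be either $H^\infty(\Omega)$ or $\mathbb C[z_1,\dots,z_n]$ (as functions on $\Omega$). Let $\operatorname{ord}(r)$, for $r\in R$, be the order of the zero of $r$ at $p$, and $\operatorname{ord}(\alpha)$ the order of the zero at $p$ of the function $f$ that represents $\alpha$ in local coordinates ($\infty$ for $r=0$, $\alpha=0$). **Theorem.** $H=A^2(E,\Omega,k)$ is an analytic Hilbert module of $E$-valued analytic $n$-forms over $R$: it is a linear space of analytic $n$-forms, $\|\cdot\|$ is a Hilbert space norm on it, it is an $R$-module under pointwise multiplication, each multiplication map $\alpha\mapsto r\alpha$ is continuous, and norm convergence in $H$ implies uniform convergence on compact sets (of the coefficient functions, in all local coordinates). It is a valuation Hilbert module over the valuation algebra $R$, that is, for $r,s\in R$, $\alpha,\beta\in H$ and $0\ne\lambda\in\mathbb C$: * $\operatorname{ord}(r)=0$ if $r$ is invertible in $R$; $\operatorname{ord}(r)=\infty$ iff $r=0$; $\operatorname{ord}(rs)\ge\operatorname{ord}(r)+\operatorname{ord}(s)$; $\operatorname{ord}(\lambda r)=\operatorname{ord}(r)$;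 $\operatorname{ord}(r+s)\ge\min(\operatorname{ord}(r),\operatorname{ord}(s))$; * $\operatorname{ord}(\alpha)=\infty$ iff $\alpha=0$; $\operatorname{ord}(r\alpha)\ge\operatorname{ord}(r)+\operatorname{ord}(\alpha)$; $\operatorname{ord}(\lambda\alpha)=\operatorname{ord}(\alpha)$; $\operatorname{ord}(\alpha+\beta)\ge\min(\operatorname{ord}(\alpha),\operatorname{ord}(\beta))$; and $\operatorname{ord}$ is upper semicontinuous on $H$. Consequently the abstract Beurling theorem and its corollary apply to $H$. For a closed subspace $V\subseteq H$ put $V_m=\{h\in V:\operatorname{ord}(h)\ge m\}$ and $W_m=V_m\ominus V_{m+1}$ ($m=0,1,2,\dots$); let $P_m^H$ be the orthogonal projection of $H$ onto $H_m\ominus H_{m+1}$, and $R_1=\{r\in R:\operatorname{ord}(r)\ge1\}$. Then the following are equivalent: 1. $V$ is $R_1$-invariant; 2. $V$ is an $R$-submodule of $H$; 3. for all $j,m\ge0$, $r\in R_1$, $h\in W_j$, $g\in V$: if $\operatorname{ord}(rh+g)>m$ then $rh+g\perp W_m$ (the decomposition is near inner), and if $\operatorname{ord}(rh+g)\ge m$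 then $P_m^H(rh+g)\in P_m^H(W_m)$ (it has the full projection property). -/

import Mathlib

open Filter Topology MeasureTheory Manifold Set
open scoped ENNReal NNReal ContDiff InnerProductSpace TensorProduct Matrix

noncomputable section

/-! ### Valuation algebras and valuation Hilbert modules -/

section Abstract

/-- `ord` is an algebra valuation on the complex algebra `R`. -/
structure IsAlgebraValuation {R : Type*} [Ring R] [Algebra ℂ R] (ord : R → ℕ∞) : Prop where
  ord_unit : ∀ r : R, ((∃ s, s * r = 1) ∨ (∃ s, r * s = 1)) → ord r = 0
  ord_eq_top_iff : ∀ r : R, ord r = ⊤ ↔ r = 0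
  ord_mul : ∀ r s : R, ord r + ord s ≤ ord (r * s)
  ord_smul : ∀ (c : ℂ) (r : R), c ≠ 0 → ord (c • r) = ord r
  ord_add : ∀ r s : R, min (ord r) (ord s) ≤ ord (r + s)

/-- `H` is a left Hilbert module over the complex algebra `R`: a complex Hilbert space and a left
`R`-module such that every multiplication map `h ↦ r • h` is continuous. -/
structure IsHilbertModule (R H : Type*) [Ring R] [Algebra ℂ R] [NormedAddCommGroup H]
    [InnerProductSpace ℂ H] [Module R H] : Prop where
  complete : CompleteSpace H
  smul_assoc : ∀ (c : ℂ) (r : R) (h : H), (c • r) • h = c • (r • h)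
  continuous_smul : ∀ r : R, Continuous fun h : H => r • h

/-- `ord` is a Hilbert module valuation on `H` with respect to `(R, ordR)`. -/
structure IsHilbertModuleValuation {R H : Type*} [Ring R] [Algebra ℂ R] [NormedAddCommGroup H]
    [InnerProductSpace ℂ H] [Module R H] (ordR : R → ℕ∞) (ord : H → ℕ∞) : Prop where
  ord_eq_top_iff : ∀ h : H, ord h = ⊤ ↔ h = 0
  ord_action : ∀ (r : R) (h : H), ordR r + ord h ≤ ord (r • h)
  ord_smul : ∀ (c : ℂ) (h : H), c ≠ 0 → ord (c • h) = ord h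
  ord_add : ∀ h₁ h₂ : H, min (ord h₁) (ord h₂) ≤ ord (h₁ + h₂)
  upperSemicontinuous : UpperSemicontinuous ord

/-- `(H, ord)` is a valuation Hilbert module over the valuation algebra `(R, ordR)`. -/
structure IsValuationHilbertModule {R H : Type*} [Ring R] [Algebra ℂ R] [NormedAddCommGroup H]
    [InnerProductSpace ℂ H] [Module R H] (ordR : R → ℕ∞) (ord : H → ℕ∞) : Prop where
  algebraValuation : IsAlgebraValuation ordR
  hilbertModule : IsHilbertModule R H
  moduleValuation : IsHilbertModuleValuation ordR ord

namespace IsValuationHilbertModule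

variable {R H : Type*} [Ring R] [Algebra ℂ R] [NormedAddCommGroup H]
  [InnerProductSpace ℂ H] [Module R H] {ordR : R → ℕ∞} {ord : H → ℕ∞}

/-- The valuation subspace series `V_k = {h ∈ V : ord h ≥ k}` of a subspace `V`. -/
def valuationSubspace (hv : IsValuationHilbertModule ordR ord) (V : Submodule ℂ H) (k : ℕ) :
    Submodule ℂ H where
  carrier := {h | h ∈ V ∧ (k : ℕ∞) ≤ ord h}
  zero_mem' := ⟨V.zero_mem, by rw [(hv.moduleValuation.ord_eq_top_iff 0).2 rfl]; exact le_top⟩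
  add_mem' := fun {a b} ha hb =>
    ⟨V.add_mem ha.1 hb.1, (le_min ha.2 hb.2).trans (hv.moduleValuation.ord_add a b)⟩
  smul_mem' := fun c h hh => by
    refine ⟨V.smul_mem c hh.1, ?_⟩
    by_cases hc : c = 0
    · rw [hc, zero_smul, (hv.moduleValuation.ord_eq_top_iff 0).2 rfl]; exact le_top
    · rw [hv.moduleValuation.ord_smul c h hc]; exact hh.2

/-- The near homogeneous components `W_k = V_k ⊖ V_{k+1}` of a subspace `V`. -/
def component (hv : IsValuationHilbertModule ordR ord) (V : Submodule ℂ H) (k : ℕ) :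
    Submodule ℂ H :=
  hv.valuationSubspace V k ⊓ (hv.valuationSubspace V (k + 1))ᗮ

theorem isClosed_valuationSubspace_top (hv : IsValuationHilbertModule ordR ord) (k : ℕ) :
    IsClosed (hv.valuationSubspace ⊤ k : Set H) := by
  have h := hv.moduleValuation.upperSemicontinuous.isClosed_preimage (k : ℕ∞)
  convert h using 1
  ext x
  simp [valuationSubspace]

theorem hasOrthogonalProjection_component_top (hv : IsValuationHilbertModule ordR ord) (k : ℕ) :
    (hv.component ⊤ k).HasOrthogonalProjection := by
  have := hv.hilbertModule.complete
  have hc : IsClosed (hv.component ⊤ k : Set H) := by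
    have := (hv.isClosed_valuationSubspace_top k).inter
      (Submodule.isClosed_orthogonal (hv.valuationSubspace ⊤ (k + 1)))
    simpa [component] using this
  have : CompleteSpace (hv.component ⊤ k) := hc.completeSpace_coe
  infer_instance

/-- `P_m^H`: the orthogonal projection of `H` onto the `m`-th near homogeneous component of `H`
itself. -/
def projection (hv : IsValuationHilbertModule ordR ord) (m : ℕ) : H →L[ℂ] H :=
  haveI := hv.hasOrthogonalProjection_component_top m
  (hv.component ⊤ m).starProjection

/-- The near homogeneous decomposition of `V` is near inner. -/
def IsNearInner (hv : IsValuationHilbertModule ordR ord) (V : Submodule ℂ H) : Prop :=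
  ∀ k m : ℕ, ∀ h ∈ hv.component V k, ∀ g ∈ V, ∀ r : R, 1 ≤ ordR r →
    (m : ℕ∞) < ord (r • h + g) → r • h + g ∈ (hv.component V m)ᗮ

/-- The near homogeneous decomposition of `V` has the full projection property. -/
def HasFullProjection (hv : IsValuationHilbertModule ordR ord) (V : Submodule ℂ H) : Prop :=
  ∀ k m : ℕ, ∀ r : R, 1 ≤ ordR r → ∀ h ∈ hv.component V k, ∀ g ∈ V,
    (m : ℕ∞) ≤ ord (r • h + g) →
      hv.projection m (r • h + g) ∈ hv.projection m '' (hv.component V m : Set H)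

/-- The conclusion of the abstract Beurling theorem and of its corollary for the valuation Hilbert
module `(H, ord)`: among the closed subspaces `V` of `H`, those invariant under
`R₁ = {r : ord r ≥ 1}`, and likewise those that are `R`-submodules, are exactly the ones whose near
homogeneous decomposition is near inner and has the full projection property. -/
def BeurlingCharacterization (hv : IsValuationHilbertModule ordR ord) : Prop :=
  ∀ V : Submodule ℂ H, IsClosed (V : Set H) →
    ((∀ r : R, 1 ≤ ordR r → ∀ h ∈ V, r • h ∈ V) ↔ hv.IsNearInner V ∧ hv.HasFullProjection V) ∧
    ((∀ r : R, ∀ h ∈ V, r • h ∈ V) ↔ hv.IsNearInner V ∧ hv.HasFullProjection V)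

end IsValuationHilbertModule

end Abstract

/-! ### The wedge product `α ∧ α⋆` of vector-valued forms at a point -/

section Wedge

variable {n : ℕ} {E : Type*} [NormedAddCommGroup E] [InnerProductSpace ℂ E]

/-- A conjugate linear involution on `E`: a conjugate linear isometry of `E` onto `E` that is its
own inverse. -/
structure ConjInvolution (E : Type*) [NormedAddCommGroup E] [InnerProductSpace ℂ E] where
  toEquiv : E ≃ₗᵢ⋆[ℂ] E
  involutive : ∀ f, toEquiv (toEquiv f) = f

/-- The bilinear form `f · g = ⟨f, g⋆⟩` on `E` for an inner product `⟨·, ·⟩` that is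
linear in its first argument (Mathlib's is linear in the second one). -/
def ConjInvolution.dot (S : ConjInvolution E) : E →ₗ[ℝ] E →ₗ[ℝ] ℂ :=
  LinearMap.mk₂ ℝ (fun f g => inner ℂ (S.toEquiv g) f)
    (fun f₁ f₂ g => inner_add_right _ _ _)
    (fun c f g => by rw [← Complex.coe_smul, inner_smul_right]; simp)
    (fun f g₁ g₂ => by rw [map_add, inner_add_left])
    (fun c f g => by
      rw [← Complex.coe_smul, LinearIsometryEquiv.map_smulₛₗ, inner_smul_left]; simp)

/-- `α⋆` for an `E`-valued `n`-covector `α`, as a real alternating form. -/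
def ConjInvolution.starForm (S : ConjInvolution E) (a : (Fin n → ℂ) [⋀^Fin n]→L[ℂ] E) :
    (Fin n → ℂ) [⋀^Fin n]→ₗ[ℝ] E :=
  LinearMap.compAlternatingMap
    ({ toFun := S.toEquiv
       map_add' := map_add _
       map_smul' := fun c f => by
        rw [← Complex.coe_smul, LinearIsometryEquiv.map_smulₛₗ]; simp } : E →ₗ[ℝ] E)
    (a.restrictScalars ℝ).toAlternatingMap

/-- The complex-valued real `2n`-covector `α ∧ α⋆`, the values of `α` and `α⋆` being multiplied
by `f · g`. The slots `Sum.inl i` are the first `n` ones, the slots `Sum.inr i` the last `n`. -/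
def ConjInvolution.wedgeStar (S : ConjInvolution E) (a : (Fin n → ℂ) [⋀^Fin n]→L[ℂ] E) :
    (Fin n → ℂ) [⋀^Fin n ⊕ Fin n]→ₗ[ℝ] ℂ :=
  LinearMap.compAlternatingMap (TensorProduct.lift S.dot)
    ((a.restrictScalars ℝ).toAlternatingMap.domCoprod (S.starForm a))

/-- The coordinate frame `∂/∂x₁, ∂/∂y₁, …, ∂/∂xₙ, ∂/∂yₙ` of `ℂⁿ`, in this order. -/
def realFrame (n : ℕ) (s : Fin n ⊕ Fin n) : Fin n → ℂ := fun i =>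
  if (finSumFinEquiv s : ℕ) = 2 * i then 1
  else if (finSumFinEquiv s : ℕ) = 2 * i + 1 then Complex.I else 0

/-- The constant `Pₙ = (-2i)ⁿ (-1)^{n(n-1)/2}`. -/
def Pconst (n : ℕ) : ℂ := (-2 * Complex.I) ^ n * (-1) ^ (n * (n - 1) / 2)

/-- The coefficient of `α ∧ α⋆ / Pₙ` with respect to `dx₁ ∧ dy₁ ∧ ⋯ ∧ dxₙ ∧ dyₙ`. -/
def ConjInvolution.density (S : ConjInvolution E) (a : (Fin n → ℂ) [⋀^Fin n]→L[ℂ] E) : ℂ :=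
  S.wedgeStar a (realFrame n) / Pconst n

end Wedge

section WedgeLemmas
variable {n : ℕ} {E : Type*} [NormedAddCommGroup E] [InnerProductSpace ℂ E]

/-- The value of `dz_s` (for `s < n`), resp. of the conjugate of `dz_{s-n}` (for `s ≥ n`), on the
`j`-th vector of the real coordinate frame. -/
def frameEntry (n s j : ℕ) : ℂ :=
  if s < n then (if j = 2 * s then 1 else if j = 2 * s + 1 then Complex.I else 0)
  else (if j = 2 * (s - n) then 1 else if j = 2 * (s - n) + 1 then -Complex.I else 0)

theorem det_frame (n : ℕ) :
    (Matrix.of fun s j : Fin (2 * n) => frameEntry n s j).det = Pconst n := by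
  induction n with
  | zero => simp [Pconst]
  | succ n ih =>
    have hP : Pconst (n + 1) = (-2 * Complex.I) * (-1) ^ n * Pconst n := by
      have : (n + 1) * (n + 1 - 1) / 2 = n * (n - 1) / 2 + n := by
        rw [← Finset.sum_range_id_mul_two (n+1) |> fun h => (Nat.div_eq_of_eq_mul_left (by norm_num) h.symm).symm,
          ← Finset.sum_range_id_mul_two n |> fun h => (Nat.div_eq_of_eq_mul_left (by norm_num) h.symm).symm,
          Finset.sum_range_succ]
      rw [Pconst, Pconst, this]; ring
    have hsub : ∀ c : Fin 2, ((Matrix.of fun s j : Fin (2 * n + 1 + 1) =>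
        frameEntry (n + 1) s j).submatrix Fin.succ (Fin.succAbove (c.castLE (by omega)))).det =
        (-1) ^ n * (if c = 0 then -Complex.I else 1) * Pconst n := by
      intro c
      have hval : ((Fin.succAbove (c.castLE (by omega : 2 ≤ 2 * n + 1 + 1)) 0 : Fin _) : ℕ) =
          if c = 0 then 1 else 0 := by
        fin_cases c
        · simp [Fin.succAbove]
        · rw [Fin.succAbove_of_castSucc_lt _ _ (by simp [Fin.lt_def])]; simp
      rw [Matrix.det_succ_column_zero, Finset.sum_eq_single (⟨n, by omega⟩ : Fin (2 * n + 1))]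
      · rw [← ih]
        congr 1
        · simp only [Matrix.submatrix_apply, Matrix.of_apply, hval]
          fin_cases c <;> simp [frameEntry]
        · congr 1
          ext s j
          have hj : ((Fin.succAbove (c.castLE (by omega : 2 ≤ 2 * n + 1 + 1)) j.succ : Fin _) : ℕ)
              = j + 2 := by
            fin_cases c <;> simp [Fin.succAbove, Fin.lt_def]
          simp only [Matrix.submatrix_apply, Matrix.of_apply, hj]
          by_cases hs : (s : ℕ) < n
          · have : (Fin.succAbove (⟨n, by omega⟩ : Fin (2 * n + 1)) s : ℕ) = s := by
              simp [Fin.succAbove, Fin.lt_def, hs]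
            simp only [Fin.val_succ, this, frameEntry, hs, if_true, Nat.add_lt_add_iff_right]
            congr 1
            · simp; omega
            · congr 1; simp; omega
          · have : (Fin.succAbove (⟨n, by omega⟩ : Fin (2 * n + 1)) s : ℕ) = s + 1 := by
              simp [Fin.succAbove, Fin.lt_def, hs]
            have h2 : ¬ ((s : ℕ) + 1 + 1 < n + 1) := by omega
            simp only [Fin.val_succ, this, frameEntry, hs, if_false, h2]
            congr 1
            · simp; omega
            · congr 1; simp; omega
      · intro b _ hb
        have hb' : (b : ℕ) ≠ n := fun h => hb (Fin.ext h)
        have : ((Fin.succAbove (c.castLE (by omega : 2 ≤ 2 * n + 1 + 1)) 0 : Fin _) : ℕ) ≤ 1 := by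
          rw [hval]; split_ifs <;> decide
        have h0 : frameEntry (n + 1) (b + 1)
            (Fin.succAbove (c.castLE (by omega : 2 ≤ 2 * n + 1 + 1)) 0 : Fin _) = 0 := by
          unfold frameEntry
          split_ifs <;> first | rfl | omega
        simp [h0]
      · simp
    have h0 := hsub 0
    have h1 := hsub 1
    rw [show (Matrix.of fun s j : Fin (2 * (n + 1)) => frameEntry (n + 1) s j) =
      (Matrix.of fun s j : Fin (2 * n + 1 + 1) => frameEntry (n + 1) s j) from rfl,
      Matrix.det_succ_row_zero, Fin.sum_univ_succ, Fin.sum_univ_succ, Finset.sum_eq_zero, hP]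
    · have e0 : (Fin.castLE (by omega : 2 ≤ 2 * n + 1 + 1) 0) = 0 := rfl
      have e1 : (Fin.castLE (by omega : 2 ≤ 2 * n + 1 + 1) 1) = Fin.succ 0 := rfl
      rw [e0] at h0
      rw [e1] at h1
      rw [h0, h1]
      simp [frameEntry]
      ring
    · intro j _
      simp [frameEntry]

/-- Every `n`-covector on `ℂⁿ` is a multiple of `dz₁ ∧ ⋯ ∧ dzₙ`. -/
theorem covector_apply (a : (Fin n → ℂ) [⋀^Fin n]→L[ℂ] E) (v : Fin n → Fin n → ℂ) :
    a v = (Matrix.of v).det • a (fun i => Pi.single i 1) := by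
  have : a.toAlternatingMap = LinearMap.compAlternatingMap
      (LinearMap.toSpanSingleton ℂ E (a (fun i => Pi.single i 1)))
      (Pi.basisFun ℂ (Fin n)).det := by
    refine (Pi.basisFun ℂ (Fin n)).ext_alternating fun w hw => ?_
    let σ : Equiv.Perm (Fin n) := Equiv.ofBijective w (Finite.injective_iff_bijective.1 hw)
    have e : (fun i => (Pi.basisFun ℂ (Fin n)) (w i)) = (Pi.basisFun ℂ (Fin n)) ∘ σ := rfl
    rw [e, AlternatingMap.map_perm, AlternatingMap.map_perm]
    congr 1
    simp only [LinearMap.compAlternatingMap_apply, Module.Basis.det_self]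
    simp only [LinearMap.toSpanSingleton_apply, one_smul]
    change a _ = a _
    congr 1
    funext i
    simp
  have h2 := congrArg (fun f => f v) this
  simp only [LinearMap.compAlternatingMap_apply] at h2
  rw [Pi.basisFun_det] at h2
  exact h2

/-- In coordinates, `α ∧ α⋆ / Pₙ = ‖f‖² dx₁ ∧ dy₁ ∧ ⋯ ∧ dxₙ ∧ dyₙ` for `α = f dz₁ ∧ ⋯ ∧ dzₙ`. -/
theorem ConjInvolution.density_eq (S : ConjInvolution E) (a : (Fin n → ℂ) [⋀^Fin n]→L[ℂ] E) :
    S.density a = ((‖a fun i => Pi.single i 1‖ ^ 2 : ℝ) : ℂ) := by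
  set f := a fun i => Pi.single i 1 with hf
  let m1 : MultilinearMap ℝ (fun _ : Fin n => Fin n → ℂ) E :=
    ((LinearMap.toSpanSingleton ℂ E f).restrictScalars ℝ).compMultilinearMap
      ((MultilinearMap.mkPiAlgebra ℝ (Fin n) ℂ).compLinearMap fun i => LinearMap.proj i)
  let m2 : MultilinearMap ℝ (fun _ : Fin n => Fin n → ℂ) E :=
    ((LinearMap.toSpanSingleton ℂ E (S.toEquiv f)).restrictScalars ℝ).compMultilinearMap
      ((MultilinearMap.mkPiAlgebra ℝ (Fin n) ℂ).compLinearMap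
        fun i => Complex.conjAe.toLinearMap ∘ₗ LinearMap.proj i)
  have h1 : (a.restrictScalars ℝ).toAlternatingMap = MultilinearMap.alternatization m1 := by
    ext v
    rw [MultilinearMap.alternatization_apply]
    change a v = _
    rw [covector_apply, ← hf, Matrix.det_apply, Finset.sum_smul]
    refine Finset.sum_congr rfl fun σ _ => ?_
    rw [smul_assoc]
    rfl
  have h2 : S.starForm a = MultilinearMap.alternatization m2 := by
    ext v
    rw [MultilinearMap.alternatization_apply]
    change S.toEquiv (a v) = _
    rw [covector_apply, ← hf, LinearIsometryEquiv.map_smulₛₗ, Matrix.det_apply, map_sum,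
      Finset.sum_smul]
    refine Finset.sum_congr rfl fun σ _ => ?_
    rw [Units.smul_def, Units.smul_def, map_zsmul, smul_assoc, map_prod]
    rfl
  have h3 : S.wedgeStar a (realFrame n) = (‖f‖ ^ 2 : ℝ) * Pconst n := by
    rw [wedgeStar, h1, h2, ← MultilinearMap.domCoprod_alternization,
      LinearMap.compAlternatingMap_apply, MultilinearMap.alternatization_apply, map_sum,
      ← det_frame]
    have hc : n + n = 2 * n := by omega
    rw [← Matrix.det_submatrix_equiv_self (finSumFinEquiv.trans (finCongr hc)),
      ← Matrix.det_transpose, Matrix.det_apply, Finset.mul_sum]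
    refine Finset.sum_congr rfl fun σ _ => ?_
    rw [Units.smul_def, Units.smul_def, map_zsmul, mul_smul_comm]
    congr 1
    rw [MultilinearMap.domDomCongr_apply, MultilinearMap.domCoprod_apply, TensorProduct.lift.tmul,
      Fintype.prod_sum_type]
    have e1 : m1 (fun i => realFrame n (σ (Sum.inl i))) =
        (∏ i : Fin n, realFrame n (σ (Sum.inl i)) i) • f := rfl
    have e2 : m2 (fun i => realFrame n (σ (Sum.inr i))) =
        (∏ i : Fin n, (starRingEnd ℂ) (realFrame n (σ (Sum.inr i)) i)) • S.toEquiv f := rfl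
    rw [e1, e2]
    change inner ℂ (S.toEquiv _) _ = _
    rw [LinearIsometryEquiv.map_smulₛₗ, S.involutive, inner_smul_left, inner_smul_right,
      inner_self_eq_norm_sq_to_K, Complex.conj_conj]
    have p1 : ∀ i : Fin n, ∀ s, (Matrix.of fun s j : Fin (2 * n) => frameEntry n s j)
        (finSumFinEquiv.trans (finCongr hc) (Sum.inl i)) (finSumFinEquiv.trans (finCongr hc) s) =
        realFrame n s i := by
      intro i s
      simp [frameEntry, realFrame]
    have p2 : ∀ i : Fin n, ∀ s, (Matrix.of fun s j : Fin (2 * n) => frameEntry n s j)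
        (finSumFinEquiv.trans (finCongr hc) (Sum.inr i)) (finSumFinEquiv.trans (finCongr hc) s) =
        (starRingEnd ℂ) (realFrame n s i) := by
      intro i s
      simp only [frameEntry, realFrame, apply_ite (starRingEnd ℂ)]
      simp
    simp only [Matrix.transpose_apply, Matrix.submatrix_apply, p1, p2]
    push_cast
    ring_nf
    rfl
  have hP : Pconst n ≠ 0 := by simp [Pconst]
  rw [density, h3, mul_div_cancel_right₀ _ hP]

end WedgeLemmas

/-! ### Analytic functions and analytic `n`-forms on an `n`-dimensional complex manifold -/

section Manifold

variable (n : ℕ) (Ω : Type*) [TopologicalSpace Ω] [ChartedSpace (Fin n → ℂ) Ω]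

/-- `E`-valued differential forms of type `(n, 0)` on `Ω`, as families of `ℂ`-multilinear
alternating maps on the tangent spaces (no regularity imposed). -/
abbrev FormField (E : Type*) [NormedAddCommGroup E] [InnerProductSpace ℂ E] : Type _ :=
  ∀ x : Ω, TangentSpace 𝓘(ℂ, Fin n → ℂ) x [⋀^Fin n]→L[ℂ] E

/-- The algebra `H^∞(Ω)` of bounded complex valued analytic functions on `Ω`. -/
def boundedAnalytic : Subalgebra ℂ (Ω → ℂ) where
  carrier := {f | ContMDiff 𝓘(ℂ, Fin n → ℂ) 𝓘(ℂ, ℂ) ω f ∧ ∃ C : ℝ, ∀ x, ‖f x‖ ≤ C}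
  mul_mem' := by
    rintro f g ⟨hf, C, hC⟩ ⟨hg, D, hD⟩
    refine ⟨hf.mul hg, C * D, fun x => ?_⟩
    rw [Pi.mul_apply, norm_mul]
    exact mul_le_mul (hC x) (hD x) (norm_nonneg _) ((norm_nonneg _).trans (hC x))
  add_mem' := by
    rintro f g ⟨hf, C, hC⟩ ⟨hg, D, hD⟩
    exact ⟨hf.add hg, C + D, fun x => (norm_add_le _ _).trans (add_le_add (hC x) (hD x))⟩
  algebraMap_mem' := fun c => ⟨contMDiff_const, ‖c‖, fun _ => le_rfl⟩

/-- The algebra of polynomials `ℂ[z₁, …, zₙ]`, as functions on the open set `U ⊆ ℂⁿ`. -/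
def polynomialAlgebraOn {n : ℕ} (U : TopologicalSpace.Opens (Fin n → ℂ)) : Subalgebra ℂ (U → ℂ) :=
  (MvPolynomial.aeval fun (i : Fin n) (z : U) => (z : Fin n → ℂ) i :
    MvPolynomial (Fin n) ℂ →ₐ[ℂ] (U → ℂ)).range

/-- The order of the zero at `z` of a function `f` analytic near `z`: the least `m` such that some
partial derivative of order `m` does not vanish at `z`. -/
def orderOfZero {n : ℕ} {F : Type*} [NormedAddCommGroup F] [NormedSpace ℂ F]
    (f : (Fin n → ℂ) → F) (z : Fin n → ℂ) : ℕ∞ :=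
  ⨅ m ∈ {m : ℕ | iteratedFDeriv ℂ m f z ≠ 0}, (m : ℕ∞)

variable {n Ω} {E : Type*} [NormedAddCommGroup E] [InnerProductSpace ℂ E]

/-- The expression `f dz₁ ∧ ⋯ ∧ dzₙ` of the form `α` in the local coordinates `e`, as a field of
covectors on the open set `e.target` of `ℂⁿ`. -/
def inChart (e : OpenPartialHomeomorph Ω (Fin n → ℂ)) (α : FormField n Ω E) (z : Fin n → ℂ) :
    (Fin n → ℂ) [⋀^Fin n]→L[ℂ] E :=
  (α (e.symm z)).compContinuousLinearMap
    (mfderiv 𝓘(ℂ, Fin n → ℂ) 𝓘(ℂ, Fin n → ℂ) e.symm z)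

/-- The function `f` in the expression `α = f dz₁ ∧ ⋯ ∧ dzₙ` in the local coordinates `e`. -/
def chartCoeff (e : OpenPartialHomeomorph Ω (Fin n → ℂ)) (α : FormField n Ω E) (z : Fin n → ℂ) :
    E :=
  inChart e α z fun i => Pi.single i 1

/-- `α` is an analytic differential `n`-form: in all local coordinates
`α = f dz₁ ∧ ⋯ ∧ dzₙ` with `f` analytic. -/
def IsAnalyticForm (α : FormField n Ω E) : Prop :=
  ∀ e ∈ IsManifold.maximalAtlas 𝓘(ℂ, Fin n → ℂ) ω Ω, AnalyticOnNhd ℂ (chartCoeff e α) e.target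

/-- The order of the zero of the function `r` at the point `p`. -/
def functionOrder (p : Ω) (r : Ω → ℂ) : ℕ∞ :=
  orderOfZero (r ∘ (chartAt (Fin n → ℂ) p).symm) (chartAt (Fin n → ℂ) p p)

/-- The order of the zero of the form `α` at the point `p`. -/
def formOrder (p : Ω) (α : FormField n Ω E) : ℕ∞ :=
  orderOfZero (chartCoeff (chartAt (Fin n → ℂ) p) α) (chartAt (Fin n → ℂ) p p)

/-- `k` is an admissible weight function: it is Lebesgue measurable and each point has a connected
open coordinate neighbourhood on which `k` is a.e. bounded below by a positive constant. -/
structure IsAdmissibleWeight (n : ℕ) {Ω : Type*} [TopologicalSpace Ω] [ChartedSpace (Fin n → ℂ) Ω]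
    (k : Ω → ℝ) : Prop where
  measurable : ∀ e ∈ IsManifold.maximalAtlas 𝓘(ℂ, Fin n → ℂ) ω Ω,
    AEMeasurable (k ∘ e.symm) (volume.restrict e.target)
  bounded_below : ∀ a : Ω, ∃ e ∈ IsManifold.maximalAtlas 𝓘(ℂ, Fin n → ℂ) ω Ω,
    a ∈ e.source ∧ IsConnected e.source ∧
      ∃ ε : ℝ, 0 < ε ∧ ∀ᵐ z ∂(volume.restrict e.target), ε < k (e.symm z)

theorem chartCoeff_add (e : OpenPartialHomeomorph Ω (Fin n → ℂ)) (α β : FormField n Ω E) :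
    chartCoeff e (α + β) = chartCoeff e α + chartCoeff e β := rfl

theorem chartCoeff_smul (e : OpenPartialHomeomorph Ω (Fin n → ℂ)) (c : ℂ) (α : FormField n Ω E) :
    chartCoeff e (c • α) = c • chartCoeff e α := rfl

variable [MeasurableSpace Ω]

/-- The measure on the domain of the local coordinates `e` with density the coefficient of
`α ∧ α⋆ / Pₙ` with respect to `dx₁ dy₁ ⋯ dxₙ dyₙ`, extended by `0` to `Ω`. -/
def chartMeasure (S : ConjInvolution E) (α : FormField n Ω E)
    (e : OpenPartialHomeomorph Ω (Fin n → ℂ)) : Measure Ω :=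
  ((volume.restrict e.target).withDensity fun z =>
    ENNReal.ofReal (S.density (inChart e α z)).re).map e.symm

/-- The volume measure `α ∧ α⋆ / Pₙ` on `Ω`, glued from its restrictions to the coordinate domains:
since these restrictions agree on overlaps, the glued measure is their least upper bound. -/
def formMeasure (S : ConjInvolution E) (α : FormField n Ω E) : Measure Ω :=
  ⨆ e ∈ IsManifold.maximalAtlas 𝓘(ℂ, Fin n → ℂ) ω Ω, chartMeasure S α e

/-- `∫_Ω k α ∧ α⋆ / Pₙ`, with values in `[0, ∞]`. -/
def weightedNormSq (S : ConjInvolution E) (k : Ω → ℝ) (α : FormField n Ω E) : ℝ≥0∞ :=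
  ∫⁻ x, ENNReal.ofReal (k x) ∂(formMeasure S α)

theorem formMeasure_le [BorelSpace Ω] (S : ConjInvolution E) {α β γ : FormField n Ω E} (hα : IsAnalyticForm α)
    (C : ℝ≥0)
    (h : ∀ e z, ‖chartCoeff e γ z‖ ^ 2 ≤ C * (‖chartCoeff e α z‖ ^ 2 + ‖chartCoeff e β z‖ ^ 2)) :
    formMeasure S γ ≤ (C : ℝ≥0∞) • (formMeasure S α + formMeasure S β) := by
  have hd : ∀ (e : OpenPartialHomeomorph Ω (Fin n → ℂ)) (δ : FormField n Ω E) z,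
      ENNReal.ofReal (S.density (inChart e δ z)).re = ENNReal.ofReal (‖chartCoeff e δ z‖ ^ 2) :=
    fun e δ z => by rw [S.density_eq, Complex.ofReal_re]; rfl
  have hle : ∀ e ∈ IsManifold.maximalAtlas 𝓘(ℂ, Fin n → ℂ) ω Ω, chartMeasure S γ e ≤
      (C : ℝ≥0∞) • (chartMeasure S α e + chartMeasure S β e) := by
    intro e he
    have hs : AEMeasurable e.symm (volume.restrict e.target) :=
      e.continuousOn_symm.aemeasurable e.open_target.measurableSet
    have hm : ∀ δ : FormField n Ω E, AEMeasurable e.symm ((volume.restrict e.target).withDensity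
        fun z => ENNReal.ofReal (S.density (inChart e δ z)).re) := fun δ =>
      hs.mono_ac (withDensity_absolutelyContinuous _ _)
    have hα' : AEMeasurable (fun z => ENNReal.ofReal (‖chartCoeff e α z‖ ^ 2))
        (volume.restrict e.target) := by
      refine ContinuousOn.aemeasurable ?_ e.open_target.measurableSet
      exact ENNReal.continuous_ofReal.comp_continuousOn ((hα e he).continuousOn.norm.pow 2)
    refine Measure.le_iff.2 fun s hs => ?_
    rw [Measure.smul_apply, Measure.add_apply, chartMeasure, chartMeasure, chartMeasure,
      Measure.map_apply_of_aemeasurable (hm γ) hs, Measure.map_apply_of_aemeasurable (hm α) hs,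
      Measure.map_apply_of_aemeasurable (hm β) hs, withDensity_apply' , withDensity_apply',
      withDensity_apply', smul_eq_mul]
    simp only [hd]
    rw [← lintegral_add_left' hα'.restrict, ← lintegral_const_mul' _ _ ENNReal.coe_ne_top]
    refine lintegral_mono fun z => ?_
    rw [← ENNReal.ofReal_add (by positivity) (by positivity), ← ENNReal.ofReal_coe_nnreal,
      ← ENNReal.ofReal_mul (NNReal.coe_nonneg C)]
    exact ENNReal.ofReal_le_ofReal (h e z)
  refine iSup₂_le fun e he => (hle e he).trans ?_
  have h1 : ∀ δ : FormField n Ω E, chartMeasure S δ e ≤ formMeasure S δ := fun δ =>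
    le_iSup₂ (f := fun e (_ : e ∈ IsManifold.maximalAtlas 𝓘(ℂ, Fin n → ℂ) ω Ω) =>
      chartMeasure S δ e) e he
  refine Measure.le_iff.2 fun s _ => ?_
  simp only [Measure.smul_apply, Measure.add_apply, smul_eq_mul]
  exact mul_le_mul_right (add_le_add (h1 α s) (h1 β s)) _

/-- The `E`-valued weighted Bergman space `A²(E, Ω, k)` of differentials. -/
def bergmanSpace [BorelSpace Ω] (S : ConjInvolution E) (k : Ω → ℝ) : Submodule ℂ (FormField n Ω E) where
  carrier := {α | IsAnalyticForm α ∧ weightedNormSq S k α < ⊤}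
  zero_mem' := by
    refine ⟨fun e _ => ?_, ?_⟩
    · have : chartCoeff e (0 : FormField n Ω E) = 0 := rfl
      rw [this]
      exact analyticOnNhd_const
    · have h0 : formMeasure S (0 : FormField n Ω E) = 0 := by
        have hz : ∀ (e : OpenPartialHomeomorph Ω (Fin n → ℂ)) z,
            S.density (inChart e (0 : FormField n Ω E) z) = 0 := fun e z => by
          rw [S.density_eq]
          change ((‖(0 : E)‖ ^ 2 : ℝ) : ℂ) = 0
          simp
        refine le_antisymm (iSup₂_le fun e _ => ?_) (Measure.zero_le _)
        simp [chartMeasure, hz]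
      simp [weightedNormSq, h0]
  add_mem' := by
    rintro α β ⟨hα, fα⟩ ⟨hβ, fβ⟩
    refine ⟨fun e he => (hα e he).add (hβ e he), ?_⟩
    have := formMeasure_le S (γ := α + β) (β := β) hα 2 fun e z => by
      rw [chartCoeff_add, Pi.add_apply]
      have := norm_add_le (chartCoeff e α z) (chartCoeff e β z)
      have h2 := norm_nonneg (chartCoeff e α z + chartCoeff e β z)
      push_cast
      nlinarith [sq_nonneg (‖chartCoeff e α z‖ - ‖chartCoeff e β z‖)]
    refine (lintegral_mono' this le_rfl).trans_lt ?_
    rw [lintegral_smul_measure, lintegral_add_measure]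
    exact ENNReal.mul_lt_top ENNReal.coe_lt_top (ENNReal.add_lt_top.2 ⟨fα, fβ⟩)
  smul_mem' := by
    rintro c α ⟨hα, fα⟩
    refine ⟨fun e he => (hα e he).const_smul, ?_⟩
    have := formMeasure_le S (γ := c • α) (β := α) hα (‖c‖₊ ^ 2) fun e z => by
      rw [chartCoeff_smul, Pi.smul_apply, norm_smul, mul_pow]
      push_cast
      have := mul_nonneg (sq_nonneg ‖c‖) (sq_nonneg ‖chartCoeff e α z‖)
      linarith
    refine (lintegral_mono' this le_rfl).trans_lt ?_
    rw [lintegral_smul_measure, lintegral_add_measure]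
    exact ENNReal.mul_lt_top ENNReal.coe_lt_top (ENNReal.add_lt_top.2 ⟨fα, fα⟩)

/-- `H`, whose elements are identified with forms through `ι`, is an analytic Hilbert module of
`E`-valued analytic `n`-forms on `Ω` over the algebra `R` of analytic functions on `Ω`. -/
structure IsAnalyticHilbertModuleOfForms (R : Subalgebra ℂ (Ω → ℂ)) {H : Type*}
    [NormedAddCommGroup H] [InnerProductSpace ℂ H] [Module R H] (ι : H →ₗ[ℂ] FormField n Ω E) :
    Prop where
  analytic_algebra : ∀ r ∈ R, ContMDiff 𝓘(ℂ, Fin n → ℂ) 𝓘(ℂ, ℂ) ω r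
  injective : Function.Injective ι
  analytic_form : ∀ h : H, IsAnalyticForm (ι h)
  hilbertModule : IsHilbertModule R H
  pointwise : ∀ (r : R) (h : H) (x : Ω), ι (r • h) x = (r : Ω → ℂ) x • ι h x
  /-- Norm convergence implies uniform convergence on compact sets, the latter being understood
  for the functions that represent the forms in local coordinates. -/
  uniform_on_compacts : ∀ (h : ℕ → H) (h₀ : H), Tendsto h atTop (𝓝 h₀) →
    ∀ e ∈ IsManifold.maximalAtlas 𝓘(ℂ, Fin n → ℂ) ω Ω, ∀ K ⊆ e.target, IsCompact K →
      TendstoUniformlyOn (fun j => chartCoeff e (ι (h j))) (chartCoeff e (ι h₀)) atTop K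

/-- There are a (necessarily unique) inner product on `A²(E, Ω, k)` with
`‖α‖² = ∫_Ω k α ∧ α⋆ / Pₙ` and a (necessarily unique) pointwise `R`-module structure that make
`A²(E, Ω, k)` an analytic Hilbert module of `n`-forms over `R` and, with the orders of the zeros at
`p`, a valuation Hilbert module over `R`, whose closed invariant subspaces are characterized as in
the abstract Beurling theorem and its corollary. -/
def BergmanSpaceIsBeurlingModule [BorelSpace Ω] (S : ConjInvolution E) (k : Ω → ℝ) (p : Ω)
    (R : Subalgebra ℂ (Ω → ℂ)) : Prop :=
  ∃ (c : InnerProductSpace.Core ℂ (bergmanSpace (n := n) S k))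
    (_M : Module R (bergmanSpace (n := n) S k)),
    letI : NormedAddCommGroup (bergmanSpace (n := n) S k) := c.toNormedAddCommGroup
    letI : InnerProductSpace ℂ (bergmanSpace (n := n) S k) := .ofCore c.toCore
    (∀ α : bergmanSpace (n := n) S k,
      ‖α‖ ^ 2 = (weightedNormSq S k (α : FormField n Ω E)).toReal) ∧
    IsAnalyticHilbertModuleOfForms R (bergmanSpace (n := n) S k).subtype ∧
    ∃ hv : IsValuationHilbertModule (fun r : R => functionOrder (n := n) p (r : Ω → ℂ))
        (fun α : bergmanSpace (n := n) S k => formOrder p (α : FormField n Ω E)),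
      hv.BeurlingCharacterization

end Manifold

end

/-! The mean value inequality on balls bounds the value of an analytic coefficient at a point,
locally uniformly, by the norm of the form. Hence norm convergence implies locally uniform
convergence of the coefficients, and by Weierstrass's theorem the Bergman space is a closed subspace
of an `L²` space, namely that of a measure assembled from countably many charts. By Cauchy's
estimates the derivatives of the coefficients at `p` are norm continuous, which makes the order
upper semicontinuous; the identity theorem shows that only the zero form has infinite order.

The abstract Beurling theorem applies because `R = ℂ + R₁`. -/

namespace IsValuationHilbertModule

variable {R H : Type*} [Ring R] [Algebra ℂ R] [NormedAddCommGroup H]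
  [InnerProductSpace ℂ H] [Module R H] {ordR : R → ℕ∞} {ord : H → ℕ∞} {V : Submodule ℂ H}

theorem isScalarTower (hv : IsValuationHilbertModule ordR ord) : IsScalarTower ℂ R H :=
  ⟨hv.hilbertModule.smul_assoc⟩

theorem min_le_ord_sub (hv : IsValuationHilbertModule ordR ord) (a b : H) :
    min (ord a) (ord b) ≤ ord (a - b) := by
  have h := hv.moduleValuation.ord_add a ((-1 : ℂ) • b)
  rwa [hv.moduleValuation.ord_smul _ _ (neg_ne_zero.2 one_ne_zero), neg_one_smul,
    ← sub_eq_add_neg] at h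

theorem isClosed_valuationSubspace (hv : IsValuationHilbertModule ordR ord)
    (hV : IsClosed (V : Set H)) (k : ℕ) : IsClosed (hv.valuationSubspace V k : Set H) := by
  have h : (hv.valuationSubspace V k : Set H) = (V : Set H) ∩ hv.valuationSubspace ⊤ k := by
    ext x
    simp [valuationSubspace]
  rw [h]
  exact hV.inter (hv.isClosed_valuationSubspace_top k)

theorem exists_component_add (hv : IsValuationHilbertModule ordR ord)
    (hV : IsClosed (V : Set H)) {k : ℕ} {x : H} (hx : x ∈ hv.valuationSubspace V k) :
    ∃ w ∈ hv.component V k, ∃ v ∈ hv.valuationSubspace V (k + 1), x = w + v := by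
  have := hv.hilbertModule.complete
  have : CompleteSpace (hv.valuationSubspace V (k + 1)) :=
    (hv.isClosed_valuationSubspace hV (k + 1)).completeSpace_coe
  set v := (hv.valuationSubspace V (k + 1)).starProjection x
  have hvV : v ∈ hv.valuationSubspace V (k + 1) := Submodule.starProjection_apply_mem _ x
  have hvk : (k : ℕ∞) ≤ ord v := (Nat.cast_le.2 k.le_succ).trans hvV.2
  exact ⟨x - v, ⟨Submodule.sub_mem _ hx ⟨hvV.1, hvk⟩,
    Submodule.sub_starProjection_mem_orthogonal x⟩, v, hvV, (sub_add_cancel x v).symm⟩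

theorem projection_eq_zero (hv : IsValuationHilbertModule ordR ord) {m : ℕ} {x : H}
    (hx : ((m + 1 : ℕ) : ℕ∞) ≤ ord x) : hv.projection m x = 0 := by
  have := hv.hasOrthogonalProjection_component_top m
  rw [projection, Submodule.starProjection_apply_eq_zero_iff, Submodule.mem_orthogonal]
  exact fun u hu => Submodule.inner_left_of_mem_orthogonal
    (K := hv.valuationSubspace ⊤ (m + 1)) ⟨trivial, hx⟩ hu.2

theorem succ_le_ord_of_projection_eq_zero (hv : IsValuationHilbertModule ordR ord) {m : ℕ} {x : H}
    (hx : (m : ℕ∞) ≤ ord x) (h0 : hv.projection m x = 0) : ((m + 1 : ℕ) : ℕ∞) ≤ ord x := by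
  have := hv.hasOrthogonalProjection_component_top m
  obtain ⟨w, hw, v, hvm, rfl⟩ := hv.exists_component_add (V := ⊤) isClosed_univ ⟨trivial, hx⟩
  rw [map_add, hv.projection_eq_zero hvm.2, add_zero, projection,
    Submodule.starProjection_eq_self_iff.2 hw] at h0
  rw [h0, zero_add]
  exact hvm.2

theorem eq_zero_of_mem_of_forall_mem_component_orthogonal (hv : IsValuationHilbertModule ordR ord)
    (hV : IsClosed (V : Set H)) {x : H} (hx : x ∈ V) (h : ∀ k, x ∈ (hv.component V k)ᗮ) :
    x = 0 := by
  have hord : ∀ k : ℕ, (k : ℕ∞) ≤ ord x := by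
    intro k
    induction k with
    | zero => exact zero_le
    | succ k ih =>
      obtain ⟨w, hw, v, hvk, hxwv⟩ := hv.exists_component_add hV ⟨hx, ih⟩
      have hwx : inner ℂ w x = 0 := Submodule.inner_right_of_mem_orthogonal hw (h k)
      have hwv : inner ℂ w v = 0 := Submodule.inner_left_of_mem_orthogonal hvk hw.2
      rw [hxwv, inner_add_right, hwv, add_zero, inner_self_eq_zero] at hwx
      rw [hxwv, hwx, zero_add]
      exact hvk.2
  exact (hv.moduleValuation.ord_eq_top_iff x).1 (ENat.eq_top_iff_forall_ge.2 hord)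

theorem le_of_component_le (hv : IsValuationHilbertModule ordR ord) {M : Submodule ℂ H}
    (hV : IsClosed (V : Set H)) (hM : IsClosed (M : Set H)) (h : ∀ k, hv.component V k ≤ M) :
    V ≤ M := by
  have := hv.hilbertModule.complete
  have : CompleteSpace (V ⊓ M : Submodule ℂ H) := (hV.inter hM).completeSpace_coe
  intro x hx
  have hxM := (V ⊓ M).starProjection_apply_mem x
  have hsub : x - (V ⊓ M).starProjection x = 0 :=
    hv.eq_zero_of_mem_of_forall_mem_component_orthogonal hV (V.sub_mem hx hxM.1) fun k =>
      Submodule.orthogonal_le (le_inf (fun _ hw => hw.1.1) (h k) : hv.component V k ≤ V ⊓ M)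
        ((V ⊓ M).sub_starProjection_mem_orthogonal x)
  rw [sub_eq_zero.1 hsub]
  exact hxM.2

theorem isNearInner_of_invariant (hv : IsValuationHilbertModule ordR ord)
    (hinv : ∀ r : R, 1 ≤ ordR r → ∀ h ∈ V, r • h ∈ V) : hv.IsNearInner V := by
  intro k m h hh g hg r hr hlt
  have hmem : r • h + g ∈ hv.valuationSubspace V (m + 1) :=
    ⟨V.add_mem (hinv r hr h hh.1.1) hg, Order.add_one_le_of_lt hlt⟩
  exact (Submodule.mem_orthogonal _ _).2 fun u hu =>
    Submodule.inner_left_of_mem_orthogonal hmem hu.2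

theorem hasFullProjection_of_invariant (hv : IsValuationHilbertModule ordR ord)
    (hV : IsClosed (V : Set H)) (hinv : ∀ r : R, 1 ≤ ordR r → ∀ h ∈ V, r • h ∈ V) :
    hv.HasFullProjection V := by
  intro k m r hr h hh g hg hle
  obtain ⟨w, hw, v, hvm, hwv⟩ := hv.exists_component_add hV
    ⟨V.add_mem (hinv r hr h hh.1.1) hg, hle⟩
  exact ⟨w, hw, by rw [hwv, map_add, hv.projection_eq_zero hvm.2, add_zero]⟩

theorem smul_add_eq_zero_of_mem_orthogonal (hv : IsValuationHilbertModule ordR ord)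
    (hinner : hv.IsNearInner V) (hfull : hv.HasFullProjection V) {r : R} (hr : 1 ≤ ordR r)
    {k : ℕ} {h : H} (hh : h ∈ hv.component V k) {g : H} (hg : g ∈ V) (hperp : r • h + g ∈ Vᗮ) :
    r • h + g = 0 := by
  rw [← hv.moduleValuation.ord_eq_top_iff]
  by_contra hne
  obtain ⟨m, hm⟩ := ENat.ne_top_iff_exists.1 hne
  -- Full projection gives `w ∈ W_m` whose subtraction raises the order of the residual above `m`.
  obtain ⟨w, hw, hproj⟩ := hfull k m r hr h hh g hg hm.le
  have hassoc : r • h + (g - w) = (r • h + g) - w := (add_sub_assoc _ _ _).symm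
  have hord : ((m + 1 : ℕ) : ℕ∞) ≤ ord (r • h + (g - w)) := by
    rw [hassoc]
    refine hv.succ_le_ord_of_projection_eq_zero
      ((le_min hm.le hw.1.2).trans (hv.min_le_ord_sub _ _)) ?_
    rw [map_sub, hproj, sub_self]
  have hlt : (m : ℕ∞) < ord (r • h + (g - w)) := (Nat.cast_lt.2 m.lt_succ_self).trans_le hord
  -- Near innerness makes the difference orthogonal to `w`, hence `w = 0`.
  have hw0 : w = 0 := by
    have hdiff : inner ℂ w (r • h + (g - w)) = 0 := Submodule.inner_right_of_mem_orthogonal hw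
      (hinner k m h hh (g - w) (V.sub_mem hg hw.1.1) r hr hlt)
    have hres : inner ℂ w (r • h + g) = 0 :=
      Submodule.inner_right_of_mem_orthogonal hw.1.1 hperp
    rwa [hassoc, inner_sub_right, hres, zero_sub, neg_eq_zero, inner_self_eq_zero] at hdiff
  rw [hw0, sub_zero, ← hm] at hlt
  exact hlt.false

theorem invariant_of_isNearInner (hv : IsValuationHilbertModule ordR ord)
    (hV : IsClosed (V : Set H)) (hinner : hv.IsNearInner V) (hfull : hv.HasFullProjection V)
    {r : R} (hr : 1 ≤ ordR r) : ∀ h ∈ V, r • h ∈ V := by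
  have := hv.hilbertModule.complete
  have := hv.isScalarTower
  have : SMulCommClass R ℂ H := IsScalarTower.to_smulCommClass'
  have : CompleteSpace V := hV.completeSpace_coe
  have hclosed : IsClosed (V.comap (Algebra.lsmul ℂ ℂ H r) : Set H) :=
    hV.preimage (hv.hilbertModule.continuous_smul r)
  refine hv.le_of_component_le hV hclosed fun k h hh => ?_
  rw [Submodule.mem_comap, Algebra.lsmul_coe]
  have hperp : r • h + -V.starProjection (r • h) ∈ Vᗮ := by
    rw [← sub_eq_add_neg]
    exact V.sub_starProjection_mem_orthogonal _
  have hzero := hv.smul_add_eq_zero_of_mem_orthogonal hinner hfull hr hh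
    (V.neg_mem (V.starProjection_apply_mem _)) hperp
  exact Submodule.starProjection_eq_self_iff.1 (add_neg_eq_zero.1 hzero).symm

theorem beurlingCharacterization (hv : IsValuationHilbertModule ordR ord)
    (hR : ∀ r : R, ∃ c : ℂ, 1 ≤ ordR (r - algebraMap ℂ R c)) : hv.BeurlingCharacterization := by
  intro V hV
  have hiff : (∀ r : R, 1 ≤ ordR r → ∀ h ∈ V, r • h ∈ V) ↔
      hv.IsNearInner V ∧ hv.HasFullProjection V :=
    ⟨fun h => ⟨hv.isNearInner_of_invariant h, hv.hasFullProjection_of_invariant hV h⟩,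
      fun h r hr => hv.invariant_of_isNearInner hV h.1 h.2 hr⟩
  refine ⟨hiff, ?_⟩
  rw [← hiff]
  refine ⟨fun h r _ => h r, fun h r x hx => ?_⟩
  obtain ⟨c, hc⟩ := hR r
  have := hv.isScalarTower
  have hsplit : r • x = (r - algebraMap ℂ R c) • x + c • x := by
    rw [sub_smul, algebraMap_smul, sub_add_cancel]
  rw [hsplit]
  exact V.add_mem (h _ hc x hx) (V.smul_mem c hx)

end IsValuationHilbertModule

section Taylor

variable {X F : Type*} [NormedAddCommGroup X] [NormedSpace ℂ X] [NormedAddCommGroup F]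
  [NormedSpace ℂ F] {f : X → F} {z z₀ : X} {R M δ : ℝ}

/-- The Taylor series of `f` at `z`, with the factorials included (unlike `ftaylorSeries`). -/
noncomputable def taylorSeries (f : X → F) (z : X) : FormalMultilinearSeries ℂ X F := fun m =>
  (m.factorial : ℂ)⁻¹ • iteratedFDeriv ℂ m f z

theorem norm_fderiv_le_of_forall_mem_ball (hδ : 0 < δ)
    (hf : DifferentiableOn ℂ f (Metric.ball z δ)) (hb : ∀ w ∈ Metric.ball z δ, ‖f w‖ ≤ M) :
    ‖fderiv ℂ f z‖ ≤ M * (2 / δ) := by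
  have hmaps : MapsTo f (Metric.ball z δ) (Metric.closedBall (f z) (2 * M)) := fun w hw =>
    calc dist (f w) (f z) ≤ ‖f w‖ + ‖f z‖ := dist_le_norm_add_norm _ _
      _ ≤ M + M := add_le_add (hb w hw) (hb z (Metric.mem_ball_self hδ))
      _ = 2 * M := (two_mul M).symm
  exact (Complex.norm_fderiv_le_div_of_mapsTo_ball hf hmaps hδ).trans_eq (by ring)

theorem le_radius_of_norm_le_geometric {p : FormalMultilinearSeries ℂ X F} {C a : ℝ} (ha : 0 < a)
    (hp : ∀ m, ‖p m‖ ≤ C * a ^ m) : ENNReal.ofReal a⁻¹ ≤ p.radius := by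
  refine p.le_radius_of_bound C fun m => ?_
  rw [Real.coe_toNNReal _ (by positivity), inv_pow]
  exact mul_inv_le_of_le_mul₀ (by positivity)
    ((norm_nonneg _).trans (by simpa using hp 0)) (hp m)

variable [CompleteSpace F]

theorem eventually_hasSum_taylorSeries (hf : AnalyticAt ℂ f z) :
    ∀ᶠ w in 𝓝 z, HasSum (fun m => taylorSeries f z m fun _ => w - z) (f w) := by
  obtain ⟨p, r, hp⟩ := hf
  have hsub : Tendsto (fun w => w - z) (𝓝 z) (𝓝 0) := by
    simpa using (continuous_id.sub continuous_const).tendsto (f := fun w : X => w - z) z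
  filter_upwards [hsub.eventually_mem (Metric.eball_mem_nhds 0 hp.r_pos)] with w hw
  simpa only [taylorSeries, smul_apply, add_sub_cancel] using hp.hasSum_iteratedFDeriv hw

theorem taylorSeries_sub {g : X → F} (hf : AnalyticAt ℂ f z) (hg : AnalyticAt ℂ g z) (m : ℕ) :
    taylorSeries (f - g) z m = taylorSeries f z m - taylorSeries g z m := by
  rw [taylorSeries, iteratedFDeriv_sub_apply hf.contDiffAt hg.contDiffAt, smul_sub]
  rfl

theorem norm_iteratedFDeriv_le_of_mem_ball (hf : AnalyticOnNhd ℂ f (Metric.ball z₀ R))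
    (hb : ∀ z ∈ Metric.ball z₀ R, ‖f z‖ ≤ M) (hδ : 0 < δ) (m : ℕ) :
    ∀ z ∈ Metric.ball z₀ (R - m * δ), ‖iteratedFDeriv ℂ m f z‖ ≤ M * (2 / δ) ^ m := by
  induction m with
  | zero => simpa using hb
  | succ m ih =>
    intro z hz
    have hsub : Metric.ball z δ ⊆ Metric.ball z₀ (R - m * δ) := by
      refine Metric.ball_subset_ball' ?_
      rw [Metric.mem_ball] at hz
      push_cast at hz
      linarith
    have hmR : R - m * δ ≤ R := sub_le_self _ (by positivity)
    rw [← norm_fderiv_iteratedFDeriv, pow_succ, ← mul_assoc]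
    exact norm_fderiv_le_of_forall_mem_ball hδ
      (fun w hw => (hf.iteratedFDeriv m w
        (Metric.ball_subset_ball hmR (hsub hw))).differentiableAt.differentiableWithinAt)
      fun w hw => ih w (hsub hw)

theorem norm_iteratedFDeriv_center_le (hR : 0 < R) (hf : AnalyticOnNhd ℂ f (Metric.ball z₀ R))
    (hb : ∀ z ∈ Metric.ball z₀ R, ‖f z‖ ≤ M) (m : ℕ) :
    ‖iteratedFDeriv ℂ m f z₀‖ ≤ M * (2 / R * (m + 1)) ^ m := by
  have hmem : z₀ ∈ Metric.ball z₀ (R - m * (R / (m + 1))) := by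
    have : R - m * (R / (m + 1)) = R / (m + 1) := by field_simp; ring
    exact Metric.mem_ball_self (by rw [this]; positivity)
  convert norm_iteratedFDeriv_le_of_mem_ball hf hb (by positivity) m z₀ hmem using 3
  field_simp

theorem norm_taylorSeries_le (hR : 0 < R) (hf : AnalyticOnNhd ℂ f (Metric.ball z₀ R))
    (hb : ∀ z ∈ Metric.ball z₀ R, ‖f z‖ ≤ M) (m : ℕ) :
    ‖taylorSeries f z₀ m‖ ≤ M * Real.exp 1 * (2 * Real.exp 1 / R) ^ m := by
  have hM : 0 ≤ M := (norm_nonneg _).trans (hb z₀ (Metric.mem_ball_self hR))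
  have hfact : (m + 1 : ℝ) ^ m / m.factorial ≤ Real.exp 1 ^ (m + 1) := by
    calc (m + 1 : ℝ) ^ m / m.factorial = (m + 1 : ℝ) ^ (m + 1) / (m + 1).factorial := by
          rw [Nat.factorial_succ, pow_succ]
          push_cast
          field_simp
      _ ≤ Real.exp (m + 1) := Real.pow_div_factorial_le_exp _ (by positivity) _
      _ = Real.exp 1 ^ (m + 1) := by rw [← Real.exp_nat_mul, mul_one]; push_cast; rfl
  calc ‖taylorSeries f z₀ m‖ = (m.factorial : ℝ)⁻¹ * ‖iteratedFDeriv ℂ m f z₀‖ := by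
        rw [taylorSeries, norm_smul, norm_inv, Complex.norm_natCast]
    _ ≤ (m.factorial : ℝ)⁻¹ * (M * (2 / R * (m + 1)) ^ m) := by
        gcongr
        exact norm_iteratedFDeriv_center_le hR hf hb m
    _ = M * (2 / R) ^ m * ((m + 1 : ℝ) ^ m / m.factorial) := by rw [mul_pow]; ring
    _ ≤ M * (2 / R) ^ m * Real.exp 1 ^ (m + 1) := by gcongr
    _ = M * Real.exp 1 * (2 * Real.exp 1 / R) ^ m := by ring

theorem hasFPowerSeriesOnBall_taylorSeries (hR : 0 < R)
    (hf : AnalyticOnNhd ℂ f (Metric.ball z₀ R)) (hb : ∀ z ∈ Metric.ball z₀ R, ‖f z‖ ≤ M) :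
    HasFPowerSeriesOnBall f (taylorSeries f z₀) z₀ (ENNReal.ofReal (2 * Real.exp 1 / R)⁻¹) := by
  have hρR : (2 * Real.exp 1 / R)⁻¹ ≤ R := by
    rw [inv_div]
    exact div_le_self hR.le (by linarith [Real.one_le_exp zero_le_one])
  set p := taylorSeries f z₀
  set ρ := (2 * Real.exp 1 / R)⁻¹
  have hρ : 0 < ρ := by positivity
  have hrad : ENNReal.ofReal ρ ≤ p.radius :=
    le_radius_of_norm_le_geometric (by positivity) (norm_taylorSeries_le hR hf hb)
  have hps : HasFPowerSeriesOnBall (fun z => p.sum (z - z₀)) p z₀ (ENNReal.ofReal ρ) := by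
    simpa using ((p.hasFPowerSeriesOnBall ((ENNReal.ofReal_pos.2 hρ).trans_le hrad)).mono
      (ENNReal.ofReal_pos.2 hρ) hrad).comp_sub z₀
  have hloc : (fun z => p.sum (z - z₀)) =ᶠ[𝓝 z₀] f :=
    (eventually_hasSum_taylorSeries (hf z₀ (Metric.mem_ball_self hR))).mono fun w hw => hw.tsum_eq
  refine hps.congr ?_
  have han := hps.analyticOnNhd
  rw [Metric.eball_ofReal] at han ⊢
  exact han.eqOn_of_preconnected_of_eventuallyEq (hf.mono (Metric.ball_subset_ball hρR))
    (convex_ball z₀ ρ).isPreconnected (Metric.mem_ball_self hρ) hloc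

end Taylor

section Weierstrass

variable {X F κ : Type*} [NormedAddCommGroup X] [NormedSpace ℂ X] [NormedAddCommGroup F]
  [NormedSpace ℂ F] [CompleteSpace F] {l : Filter κ} [l.NeBot] {f : κ → X → F} {g : X → F}
  {z₀ : X} {R : ℝ}

theorem cauchy_map_taylorSeries (hR : 0 < R)
    (hf : ∀ᶠ j in l, AnalyticOnNhd ℂ (f j) (Metric.ball z₀ R))
    (hc : UniformCauchySeqOn f l (Metric.ball z₀ R)) (m : ℕ) :
    Cauchy (map (fun j => taylorSeries (f j) z₀ m) l) := by
  refine cauchy_map_iff.2 ⟨‹_›, Metric.uniformity_basis_dist_le.tendsto_right_iff.2 fun ε hε => ?_⟩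
  set K := Real.exp 1 * (2 * Real.exp 1 / R) ^ m
  have hK : 0 < K := by positivity
  filter_upwards [hf.prod_mk hf, hc _ (Metric.dist_mem_uniformity (div_pos hε hK))]
    with ⟨i, j⟩ ⟨hi, hj⟩ hij
  have hz₀ := Metric.mem_ball_self (x := z₀) hR
  calc dist (taylorSeries (f i) z₀ m) (taylorSeries (f j) z₀ m)
      = ‖taylorSeries (f i - f j) z₀ m‖ := by
        rw [taylorSeries_sub (hi z₀ hz₀) (hj z₀ hz₀)]
        exact dist_eq_norm _ _
    _ ≤ ε / K * Real.exp 1 * (2 * Real.exp 1 / R) ^ m :=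
        norm_taylorSeries_le hR (hi.sub hj)
          (fun z hz => by simpa only [Pi.sub_apply, dist_eq_norm] using (hij z hz).le) m
    _ = ε / K * K := mul_assoc _ _ _
    _ = ε := div_mul_cancel₀ ε hK.ne'

theorem hasFPowerSeriesOnBall_of_tendsto {P : κ → FormalMultilinearSeries ℂ X F}
    {p : FormalMultilinearSeries ℂ X F} {C a : ℝ} (ha : 0 < a)
    (hf : ∀ᶠ j in l, HasFPowerSeriesOnBall (f j) (P j) z₀ (ENNReal.ofReal a⁻¹))
    (hP : ∀ᶠ j in l, ∀ m, ‖P j m‖ ≤ C * a ^ m)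
    (hp : ∀ m, Tendsto (fun j => P j m) l (𝓝 (p m)))
    (hg : ∀ z ∈ Metric.ball z₀ a⁻¹, Tendsto (fun j => f j z) l (𝓝 (g z))) :
    HasFPowerSeriesOnBall g p z₀ (ENNReal.ofReal a⁻¹) := by
  have hpb : ∀ m, ‖p m‖ ≤ C * a ^ m := fun m =>
    le_of_tendsto (hp m).norm (hP.mono fun j hj => hj m)
  refine ⟨le_radius_of_norm_le_geometric ha hpb, ENNReal.ofReal_pos.2 (inv_pos.2 ha),
    fun {y} hy => ?_⟩
  have hy' : z₀ + y ∈ Metric.ball z₀ a⁻¹ := by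
    simpa [Metric.eball_ofReal, mem_ball_iff_norm] using hy
  have hay : a * ‖y‖ < 1 := by
    rw [Metric.eball_ofReal, mem_ball_zero_iff] at hy
    calc a * ‖y‖ < a * a⁻¹ := by gcongr
      _ = 1 := mul_inv_cancel₀ ha.ne'
  have hsum : Summable fun m => C * (a * ‖y‖) ^ m :=
    (summable_geometric_of_lt_one (by positivity) hay).mul_left C
  have hterm : ∀ q : FormalMultilinearSeries ℂ X F, (∀ m, ‖q m‖ ≤ C * a ^ m) →
      ∀ m, ‖q m fun _ => y‖ ≤ C * (a * ‖y‖) ^ m := fun q hq m =>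
    calc ‖q m fun _ => y‖ ≤ ‖q m‖ * ‖y‖ ^ m := by simpa using (q m).le_opNorm fun _ => y
      _ ≤ C * a ^ m * ‖y‖ ^ m := by gcongr; exact hq m
      _ = C * (a * ‖y‖) ^ m := by rw [mul_pow, mul_assoc]
  have hlim : Tendsto (fun j => ∑' m, P j m fun _ => y) l (𝓝 (∑' m, p m fun _ => y)) :=
    tendsto_tsum_of_dominated_convergence hsum
      (fun m => ((ContinuousMultilinearMap.apply ℂ (fun _ => X) F fun _ => y).continuous.tendsto
        _).comp (hp m))
      (hP.mono fun j hj => hterm (P j) hj)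
  have hlim' : Tendsto (fun j => ∑' m, P j m fun _ => y) l (𝓝 (g (z₀ + y))) :=
    (hg _ hy').congr' (hf.mono fun j hj => (hj.hasSum hy).tsum_eq.symm)
  rw [tendsto_nhds_unique hlim' hlim]
  exact (Summable.of_norm_bounded hsum (hterm p hpb)).hasSum

theorem analyticAt_of_tendstoUniformlyOn_of_bounded {M : ℝ} (hR : 0 < R)
    (hf : ∀ᶠ j in l, AnalyticOnNhd ℂ (f j) (Metric.ball z₀ R))
    (hb : ∀ᶠ j in l, ∀ z ∈ Metric.ball z₀ R, ‖f j z‖ ≤ M)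
    (hfg : TendstoUniformlyOn f g l (Metric.ball z₀ R)) : AnalyticAt ℂ g z₀ := by
  have ha : 0 < 2 * Real.exp 1 / R := by positivity
  have haR : (2 * Real.exp 1 / R)⁻¹ ≤ R := by
    rw [inv_div]
    exact div_le_self hR.le (by linarith [Real.one_le_exp zero_le_one])
  choose p hp using fun m => CompleteSpace.complete
    (cauchy_map_taylorSeries hR hf hfg.uniformCauchySeqOn m)
  exact (hasFPowerSeriesOnBall_of_tendsto (p := p) ha
    ((hf.and hb).mono fun j hj => hasFPowerSeriesOnBall_taylorSeries hR hj.1 hj.2)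
    ((hf.and hb).mono fun j hj => norm_taylorSeries_le hR hj.1 hj.2) hp
    fun z hz => hfg.tendsto_at (Metric.ball_subset_ball haR hz)).analyticAt

theorem analyticAt_of_tendstoUniformlyOn (hR : 0 < R)
    (hf : ∀ᶠ j in l, AnalyticOnNhd ℂ (f j) (Metric.ball z₀ R))
    (hfg : TendstoUniformlyOn f g l (Metric.ball z₀ R)) : AnalyticAt ℂ g z₀ := by
  have hclose := Metric.tendstoUniformlyOn_iff.1 hfg 1 one_pos
  obtain ⟨i, hi, hgi⟩ := (hf.and hclose).exists
  have hbound : ∀ᶠ j in l, ∀ z ∈ Metric.ball z₀ R, ‖f j z - f i z‖ ≤ 1 + 1 :=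
    hclose.mono fun j hgj z hz => by
      rw [← dist_eq_norm]
      exact (dist_triangle_left _ _ (g z)).trans (add_le_add (hgj z hz).le (hgi z hz).le)
  have hsub : TendstoUniformlyOn (fun j z => f j z - f i z) (fun z => g z - f i z) l
      (Metric.ball z₀ R) := by
    refine Metric.tendstoUniformlyOn_iff.2 fun ε hε => ?_
    simpa only [dist_sub_right] using Metric.tendstoUniformlyOn_iff.1 hfg ε hε
  simpa using (analyticAt_of_tendstoUniformlyOn_of_bounded hR (hf.mono fun j hj => hj.sub hi)
    hbound hsub).fun_add (hi z₀ (Metric.mem_ball_self hR))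

end Weierstrass

section OrderOfZero

theorem norm_iteratedFDeriv_smul_le_of_analyticAt {X F : Type*} [NormedAddCommGroup X]
    [NormedSpace ℂ X] [NormedAddCommGroup F] [NormedSpace ℂ F] [CompleteSpace F]
    {r : X → ℂ} {f : X → F} {z : X} (hr : AnalyticAt ℂ r z) (hf : AnalyticAt ℂ f z) (j : ℕ) :
    ‖iteratedFDeriv ℂ j (fun w => r w • f w) z‖ ≤ ∑ i ∈ Finset.range (j + 1),
      (j.choose i : ℝ) * ‖iteratedFDeriv ℂ i r z‖ * ‖iteratedFDeriv ℂ (j - i) f z‖ := by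
  obtain ⟨s, hs, hso, hzs⟩ := eventually_nhds_iff.1
    (hr.eventually_analyticAt.and hf.eventually_analyticAt)
  have hrs : ContDiffOn ℂ ω r s := fun w hw => (hs w hw).1.contDiffAt.contDiffWithinAt
  have hfs : ContDiffOn ℂ ω f s := fun w hw => (hs w hw).2.contDiffAt.contDiffWithinAt
  simpa only [iteratedFDerivWithin_of_isOpen _ hso hzs] using
    norm_iteratedFDerivWithin_smul_le hrs hfs hso.uniqueDiffOn hzs (n := j) le_top

variable {n : ℕ} {F : Type*} [NormedAddCommGroup F] [NormedSpace ℂ F] {f g : (Fin n → ℂ) → F}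
  {z : Fin n → ℂ}

theorem le_orderOfZero_iff {m : ℕ} :
    (m : ℕ∞) ≤ orderOfZero f z ↔ ∀ j < m, iteratedFDeriv ℂ j f z = 0 := by
  simp only [orderOfZero, le_iInf_iff, mem_ofPred_eq, Nat.cast_le]
  refine forall_congr' fun j => ?_
  rw [← not_imp_not, not_le, not_not]

theorem iteratedFDeriv_eq_zero_of_lt_orderOfZero {m : ℕ} (h : (m : ℕ∞) < orderOfZero f z) :
    iteratedFDeriv ℂ m f z = 0 :=
  le_orderOfZero_iff.1 (Order.add_one_le_of_lt h) m m.lt_succ_self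

theorem orderOfZero_eq_top_iff : orderOfZero f z = ⊤ ↔ ∀ j, iteratedFDeriv ℂ j f z = 0 := by
  simp only [ENat.eq_top_iff_forall_ge, le_orderOfZero_iff]
  exact ⟨fun h j => h (j + 1) j j.lt_succ_self, fun h _ j _ => h j⟩

theorem one_le_orderOfZero_iff : 1 ≤ orderOfZero f z ↔ f z = 0 := by
  rw [← Nat.cast_one, le_orderOfZero_iff]
  simp only [Nat.lt_one_iff, forall_eq]
  rw [← norm_eq_zero, norm_iteratedFDeriv_zero, norm_eq_zero]

variable [CompleteSpace F]

theorem min_orderOfZero_le_add (hf : AnalyticAt ℂ f z) (hg : AnalyticAt ℂ g z) :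
    min (orderOfZero f z) (orderOfZero g z) ≤ orderOfZero (f + g) z := by
  refine ENat.forall_natCast_le_iff_le.1 fun m hm => le_orderOfZero_iff.2 fun j hj => ?_
  rw [le_min_iff, le_orderOfZero_iff, le_orderOfZero_iff] at hm
  rw [iteratedFDeriv_add_apply hf.contDiffAt hg.contDiffAt, hm.1 j hj, hm.2 j hj, add_zero]

theorem orderOfZero_const_smul (hf : AnalyticAt ℂ f z) {c : ℂ} (hc : c ≠ 0) :
    orderOfZero (c • f) z = orderOfZero f z := by
  have : ∀ j, iteratedFDeriv ℂ j (c • f) z = c • iteratedFDeriv ℂ j f z := fun j =>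
    iteratedFDeriv_const_smul_apply hf.contDiffAt
  simp [orderOfZero, this, hc]

theorem orderOfZero_add_le_smul {r : (Fin n → ℂ) → ℂ} (hr : AnalyticAt ℂ r z)
    (hf : AnalyticAt ℂ f z) :
    orderOfZero r z + orderOfZero f z ≤ orderOfZero (fun w => r w • f w) z := by
  refine ENat.forall_natCast_le_iff_le.1 fun m hm => le_orderOfZero_iff.2 fun j hj => ?_
  have hterm : ∀ i ≤ j, iteratedFDeriv ℂ i r z = 0 ∨ iteratedFDeriv ℂ (j - i) f z = 0 := by
    intro i hi
    by_contra! h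
    have hle : (m : ℕ∞) ≤ (i : ℕ∞) + (j - i : ℕ) := hm.trans (add_le_add
      (not_lt.1 (mt iteratedFDeriv_eq_zero_of_lt_orderOfZero h.1))
      (not_lt.1 (mt iteratedFDeriv_eq_zero_of_lt_orderOfZero h.2)))
    have : m ≤ i + (j - i) := by exact_mod_cast hle
    omega
  rw [← norm_le_zero_iff]
  refine (norm_iteratedFDeriv_smul_le_of_analyticAt hr hf j).trans
    (Finset.sum_nonpos fun i hi => le_of_eq ?_)
  rcases hterm i (Finset.mem_range_succ_iff.1 hi) with h | h <;> simp [h]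

theorem orderOfZero_eq_top_iff_eventuallyEq (hf : AnalyticAt ℂ f z) :
    orderOfZero f z = ⊤ ↔ f =ᶠ[𝓝 z] 0 := by
  rw [orderOfZero_eq_top_iff]
  refine ⟨fun h => ?_, fun h j => ?_⟩
  · filter_upwards [eventually_hasSum_taylorSeries hf] with w hw
    exact hw.unique (by simp [taylorSeries, h, hasSum_zero])
  · simpa [Pi.zero_def, iteratedFDeriv_fun_zero] using (h.iteratedFDeriv ℂ j).self_of_nhds

end OrderOfZero

section MeanValue

theorem enorm_mul_two_pi_le_lintegral_circle {X F : Type*} [NormedAddCommGroup X] [NormedSpace ℂ X]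
    [NormedAddCommGroup F] [NormedSpace ℂ F] [CompleteSpace F] {f : X → F} {z w : X}
    (hf : ∀ c ∈ Metric.closedBall (0 : ℂ) 1, DifferentiableAt ℂ f (z + c • w)) :
    ‖f z‖ₑ * ENNReal.ofReal (2 * Real.pi) ≤
      ∫⁻ θ in Ioc 0 (2 * Real.pi), ‖f (z + circleMap 0 1 θ • w)‖ₑ := by
  have hd : DiffContOnCl ℂ (fun c : ℂ => f (z + c • w)) (Metric.ball 0 |1|) := by
    refine DifferentiableOn.diffContOnCl fun c hc => ?_
    rw [abs_one, closure_ball _ one_ne_zero] at hc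
    exact ((hf c hc).comp c (by fun_prop)).differentiableWithinAt
  have h := hd.circleAverage
  rw [Real.circleAverage_def, zero_smul, add_zero,
    intervalIntegral.integral_of_le Real.two_pi_pos.le, inv_smul_eq_iff₀ Real.two_pi_pos.ne'] at h
  calc ‖f z‖ₑ * ENNReal.ofReal (2 * Real.pi) = ‖(2 * Real.pi) • f z‖ₑ := by
        rw [enorm_smul, Real.enorm_of_nonneg Real.two_pi_pos.le, mul_comm]
    _ ≤ ∫⁻ θ in Ioc 0 (2 * Real.pi), ‖f (z + circleMap 0 1 θ • w)‖ₑ := by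
        rw [← h]
        exact enorm_integral_le_lintegral_enorm _

variable {n : ℕ} {E : Type*} [NormedAddCommGroup E] [NormedSpace ℂ E] [CompleteSpace E]
  {f : (Fin n → ℂ) → E} {z : Fin n → ℂ} {R : ℝ}

theorem setLIntegral_ball_unit_smul {c : ℂ} (hc : ‖c‖ = 1) (g : (Fin n → ℂ) → ℝ≥0∞) (R : ℝ) :
    ∫⁻ w in Metric.ball 0 R, g (c • w) = ∫⁻ w in Metric.ball 0 R, g w := by
  have hpres : MeasurePreserving (fun w : Fin n → ℂ => c • w) :=
    volume_preserving_pi fun _ : Fin n =>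
      (rotation ⟨c, mem_sphere_zero_iff_norm.2 hc⟩).measurePreserving
  have hball : (fun w : Fin n → ℂ => c • w) ⁻¹' Metric.ball 0 R = Metric.ball 0 R := by
    ext w
    simp [norm_smul, hc]
  have hc0 : c ≠ 0 := norm_ne_zero_iff.1 (hc ▸ one_ne_zero)
  simpa only [hball] using
    hpres.setLIntegral_comp_preimage_emb (measurableEmbedding_const_smul₀ hc0) g (Metric.ball 0 R)

theorem setLIntegral_ball_comp_add_left (g : (Fin n → ℂ) → ℝ≥0∞) (z : Fin n → ℂ) (R : ℝ) :
    ∫⁻ w in Metric.ball 0 R, g (z + w) = ∫⁻ w in Metric.ball z R, g w := by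
  have h := (measurePreserving_add_left volume z).setLIntegral_comp_preimage_emb
    (measurableEmbedding_addLeft z) g (Metric.ball z R)
  rwa [preimage_add_ball, sub_self] at h

theorem enorm_zero_mul_volume_ball_le (hf : AnalyticOnNhd ℂ f (Metric.ball 0 R)) :
    ‖f 0‖ₑ * volume (Metric.ball (0 : Fin n → ℂ) R) ≤ ∫⁻ w in Metric.ball 0 R, ‖f w‖ₑ := by
  set B := Metric.ball (0 : Fin n → ℂ) R
  have hmul : ∀ w ∈ B, ∀ c ∈ Metric.closedBall (0 : ℂ) 1, c • w ∈ B := fun w hw c hc => by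
    rw [mem_closedBall_zero_iff] at hc
    rw [mem_ball_zero_iff] at hw ⊢
    exact (norm_smul c w ▸ mul_le_of_le_one_left (norm_nonneg w) hc).trans_lt hw
  have hmeas : AEMeasurable (Function.uncurry fun (w : Fin n → ℂ) (θ : ℝ) =>
      ‖f (circleMap 0 1 θ • w)‖ₑ)
      ((volume.restrict B).prod (volume.restrict (Ioc 0 (2 * Real.pi)))) := by
    rw [Measure.prod_restrict]
    refine ContinuousOn.aemeasurable ?_ (measurableSet_ball.prod measurableSet_Ioc)
    have hcont : Continuous fun q : (Fin n → ℂ) × ℝ => circleMap 0 1 q.2 • q.1 :=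
      ((continuous_circleMap 0 1).comp continuous_snd).smul continuous_fst
    have hmaps : MapsTo (fun q : (Fin n → ℂ) × ℝ => circleMap 0 1 q.2 • q.1)
        (B ×ˢ Ioc 0 (2 * Real.pi)) B := fun q hq => hmul q.1 hq.1 _ (by simp)
    exact (hf.continuousOn.comp hcont.continuousOn hmaps).enorm
  have hpi : ENNReal.ofReal (2 * Real.pi) ≠ 0 := by simp [Real.pi_pos]
  refine (ENNReal.mul_le_mul_iff_left hpi ENNReal.ofReal_ne_top).1 ?_
  calc ‖f 0‖ₑ * volume B * ENNReal.ofReal (2 * Real.pi)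
      = ∫⁻ _ in B, ‖f 0‖ₑ * ENNReal.ofReal (2 * Real.pi) := by
        rw [setLIntegral_const, mul_right_comm]
    _ ≤ ∫⁻ w in B, ∫⁻ θ in Ioc 0 (2 * Real.pi), ‖f (circleMap 0 1 θ • w)‖ₑ := by
        refine setLIntegral_mono' measurableSet_ball fun w hw => ?_
        have hd : ∀ c ∈ Metric.closedBall (0 : ℂ) 1, DifferentiableAt ℂ f (0 + c • w) :=
          fun c hc => by simpa using (hf _ (hmul w hw c hc)).differentiableAt
        simpa using enorm_mul_two_pi_le_lintegral_circle hd
    _ = ∫⁻ θ in Ioc 0 (2 * Real.pi), ∫⁻ w in B, ‖f (circleMap 0 1 θ • w)‖ₑ :=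
        lintegral_lintegral_swap hmeas
    _ = ∫⁻ _ in Ioc 0 (2 * Real.pi), ∫⁻ w in B, ‖f w‖ₑ := by
        refine lintegral_congr fun θ => ?_
        exact setLIntegral_ball_unit_smul (by simp) (fun w => ‖f w‖ₑ) R
    _ = (∫⁻ w in B, ‖f w‖ₑ) * ENNReal.ofReal (2 * Real.pi) := by
        rw [setLIntegral_const, Real.volume_Ioc, sub_zero]

theorem enorm_mul_volume_ball_le (hf : AnalyticOnNhd ℂ f (Metric.ball z R)) :
    ‖f z‖ₑ * volume (Metric.ball z R) ≤ ∫⁻ w in Metric.ball z R, ‖f w‖ₑ := by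
  have hf' : AnalyticOnNhd ℂ (fun w => f (z + w)) (Metric.ball 0 R) := fun w hw =>
    (hf (z + w) (by simpa [mem_ball_iff_norm] using hw)).comp (by fun_prop)
  simpa only [add_zero, ← setLIntegral_ball_comp_add_left (fun w => ‖f w‖ₑ) z R,
    ← Measure.addHaar_ball_center volume z R] using enorm_zero_mul_volume_ball_le hf'

theorem enorm_sq_mul_volume_ball_le (hR : 0 < R) (hf : AnalyticOnNhd ℂ f (Metric.ball z R)) :
    ‖f z‖ₑ ^ 2 * volume (Metric.ball z R) ≤ ∫⁻ w in Metric.ball z R, ‖f w‖ₑ ^ 2 := by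
  set v := volume (Metric.ball z R)
  have hv0 : v ≠ 0 := (Metric.measure_ball_pos _ _ hR).ne'
  have hv : v ≠ ⊤ := measure_ball_lt_top.ne
  have hholder : ∫⁻ w in Metric.ball z R, ‖f w‖ₑ ≤
      (∫⁻ w in Metric.ball z R, ‖f w‖ₑ ^ 2) ^ (1 / 2 : ℝ) * v ^ (1 / 2 : ℝ) := by
    simpa using ENNReal.lintegral_mul_le_Lp_mul_Lq (volume.restrict (Metric.ball z R))
      Real.HolderConjugate.two_two (f := fun w => ‖f w‖ₑ) (g := fun _ => 1)
      (hf.continuousOn.enorm.aemeasurable measurableSet_ball) aemeasurable_const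
  have hsqrt : ∀ a : ℝ≥0∞, (a ^ (1 / 2 : ℝ)) ^ 2 = a := fun a => by
    rw [← ENNReal.rpow_two, ← ENNReal.rpow_mul, one_div_mul_cancel two_ne_zero, ENNReal.rpow_one]
  refine (ENNReal.mul_le_mul_iff_left hv0 hv).1 ?_
  calc ‖f z‖ₑ ^ 2 * v * v = (‖f z‖ₑ * v) ^ 2 := by ring
    _ ≤ ((∫⁻ w in Metric.ball z R, ‖f w‖ₑ ^ 2) ^ (1 / 2 : ℝ) * v ^ (1 / 2 : ℝ)) ^ 2 := by
        exact pow_le_pow_left₀ zero_le ((enorm_mul_volume_ball_le hf).trans hholder) 2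
    _ = (∫⁻ w in Metric.ball z R, ‖f w‖ₑ ^ 2) * v := by rw [mul_pow, hsqrt, hsqrt]

end MeanValue

/-! ### Forms and their coefficients in local coordinates -/

theorem eq_univ_of_mem_nhds_of_analytic {X F M : Type*} [NormedAddCommGroup X] [NormedSpace ℂ X]
    [NormedAddCommGroup F] [NormedSpace ℂ F] [TopologicalSpace M] [PreconnectedSpace M]
    [ChartedSpace X M] {Z : Set M} {p : M} (hp : Z ∈ 𝓝 p)
    (hZ : ∀ x : M, ∃ f : X → F, AnalyticOnNhd ℂ f (chartAt X x).target ∧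
      ∀ y ∈ (chartAt X x).source, y ∈ Z ↔ f (chartAt X x y) = 0) :
    Z = univ := by
  have hclosed : IsClosed (interior Z) := by
    refine isClosed_of_closure_subset fun x hx => ?_
    obtain ⟨f, hf, hfZ⟩ := hZ x
    set e := chartAt X x
    have hxe : x ∈ e.source := mem_chart_source _ x
    obtain ⟨ρ, hρ, hball⟩ := Metric.isOpen_iff.1 e.open_target _ (e.map_source hxe)
    have hopen : IsOpen (e.source ∩ e ⁻¹' Metric.ball (e x) ρ) :=
      e.isOpen_inter_preimage Metric.isOpen_ball
    obtain ⟨y, ⟨hye, hyb⟩, hyZ⟩ := mem_closure_iff.1 hx _ hopen ⟨hxe, Metric.mem_ball_self hρ⟩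
    have hf0 : f =ᶠ[𝓝 (e y)] 0 := by
      have hmem : ∀ᶠ w in 𝓝 (e y), e.symm w ∈ interior Z := by
        refine (e.continuousAt_symm (e.map_source hye)).eventually_mem ?_
        rw [e.left_inv hye]
        exact isOpen_interior.mem_nhds hyZ
      filter_upwards [hmem, e.open_target.mem_nhds (e.map_source hye)] with w hw hwt
      have := (hfZ _ (e.map_target hwt)).1 (interior_subset hw)
      rwa [e.right_inv hwt] at this
    have hball0 := (hf.mono hball).eqOn_zero_of_preconnected_of_eventuallyEq_zero
      (convex_ball (e x) ρ).isPreconnected hyb hf0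
    exact mem_interior.2 ⟨_, fun w hw => (hfZ w hw.1).2 (hball0 hw.2), hopen,
      hxe, Metric.mem_ball_self hρ⟩
  have := IsClopen.eq_univ ⟨hclosed, isOpen_interior⟩ ⟨p, mem_interior_iff_mem_nhds.2 hp⟩
  exact univ_subset_iff.1 (this ▸ interior_subset)

section Manifold

variable {n : ℕ} {Ω : Type*} [TopologicalSpace Ω] [ChartedSpace (Fin n → ℂ) Ω]
variable {E : Type*} [NormedAddCommGroup E] [InnerProductSpace ℂ E]

/-- The covector `α x` on the model space `ℂⁿ` of the tangent space at `x`, a type synonym of it;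
the definition only changes the type. -/
def covectorAt (α : FormField n Ω E) (x : Ω) : (Fin n → ℂ) [⋀^Fin n]→L[ℂ] E := α x

/-- The coefficient of the covector `α x` with respect to the covector `dz₁ ∧ ⋯ ∧ dzₙ` of the model
space of the tangent space, that is, in the preferred chart at `x`. Unlike `chartCoeff` it need not
be continuous in `x`. -/
noncomputable def covectorCoeff (α : FormField n Ω E) (x : Ω) : E :=
  covectorAt α x fun i => Pi.single i 1

/-- The derivative of the inverse of the chart `e`, as a map of the model spaces of the tangent
spaces. -/
noncomputable def chartSymmDeriv (e : OpenPartialHomeomorph Ω (Fin n → ℂ)) (z : Fin n → ℂ) :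
    (Fin n → ℂ) →L[ℂ] (Fin n → ℂ) :=
  mfderiv 𝓘(ℂ, Fin n → ℂ) 𝓘(ℂ, Fin n → ℂ) e.symm z

/-- The complex Jacobian determinant of the inverse of the chart `e`. -/
noncomputable def chartJacobian (e : OpenPartialHomeomorph Ω (Fin n → ℂ)) (z : Fin n → ℂ) : ℂ :=
  (chartSymmDeriv e z).det

theorem det_matrixOf_apply_single (A : (Fin n → ℂ) →L[ℂ] (Fin n → ℂ)) :
    (Matrix.of fun i => A (Pi.single i 1)).det = A.det := by
  rw [ContinuousLinearMap.det, ← LinearMap.det_toMatrix', ← Matrix.det_transpose]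
  congr 1

theorem chartCoeff_eq (e : OpenPartialHomeomorph Ω (Fin n → ℂ)) (α : FormField n Ω E)
    (z : Fin n → ℂ) :
    chartCoeff e α z = chartJacobian e z • covectorCoeff α (e.symm z) := by
  have h := covector_apply (covectorAt α (e.symm z)) fun i =>
    chartSymmDeriv e z (Pi.single i 1)
  rw [det_matrixOf_apply_single] at h
  exact h

/-- The form with the coefficients `u` in the sense of `covectorCoeff`. -/
noncomputable def formOfCoeff (u : Ω → E) : FormField n Ω E := fun x =>
  (((ContinuousLinearMap.toSpanSingleton ℂ (u x)).compContinuousAlternatingMap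
    { (Matrix.detRowAlternating : (Fin n → ℂ) [⋀^Fin n]→ₗ[ℂ] ℂ) with
      cont := Continuous.matrix_det continuous_id } : (Fin n → ℂ) [⋀^Fin n]→L[ℂ] E))

theorem covectorCoeff_formOfCoeff (u : Ω → E) :
    covectorCoeff (formOfCoeff (n := n) u) = u := by
  funext x
  change (Matrix.det fun i : Fin n => (Pi.single i 1 : Fin n → ℂ)) • u x = u x
  have : (fun i : Fin n => (Pi.single i 1 : Fin n → ℂ)) = (1 : Matrix (Fin n) (Fin n) ℂ) := by
    ext i j
    simp [Matrix.one_apply, Pi.single_apply, eq_comm]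
  rw [this, Matrix.det_one, one_smul]

theorem eq_of_covectorCoeff_eq {α β : FormField n Ω E}
    (h : ∀ x, covectorCoeff α x = covectorCoeff β x) : α = β := by
  funext x
  have hx : covectorAt α x = covectorAt β x := by
    ext v
    rw [covector_apply (covectorAt α x), covector_apply (covectorAt β x)]
    exact congrArg _ (h x)
  exact hx

variable {e e' : OpenPartialHomeomorph Ω (Fin n → ℂ)}

theorem mdifferentiable_of_mem_maximalAtlas
    (he : e ∈ IsManifold.maximalAtlas 𝓘(ℂ, Fin n → ℂ) ω Ω) :
    e.MDifferentiable 𝓘(ℂ, Fin n → ℂ) 𝓘(ℂ, Fin n → ℂ) :=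
  ⟨(contMDiffOn_of_mem_maximalAtlas he).mdifferentiableOn (by simp),
    (contMDiffOn_symm_of_mem_maximalAtlas he).mdifferentiableOn (by simp)⟩

theorem analyticOnNhd_comp_symm {r : Ω → ℂ} (hr : ContMDiff 𝓘(ℂ, Fin n → ℂ) 𝓘(ℂ, ℂ) ω r)
    (he : e ∈ IsManifold.maximalAtlas 𝓘(ℂ, Fin n → ℂ) ω Ω) :
    AnalyticOnNhd ℂ (r ∘ e.symm) e.target := by
  rw [← e.open_target.analyticOn_iff_analyticOnNhd, ← contDiffOn_omega_iff_analyticOn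
    e.open_target.uniqueDiffOn, ← contMDiffOn_iff_contDiffOn]
  exact hr.comp_contMDiffOn (contMDiffOn_symm_of_mem_maximalAtlas he)

theorem chartJacobian_ne_zero
    (he : e ∈ IsManifold.maximalAtlas 𝓘(ℂ, Fin n → ℂ) ω Ω) {z : Fin n → ℂ} (hz : z ∈ e.target) :
    chartJacobian e z ≠ 0 := by
  have hid := (mdifferentiable_of_mem_maximalAtlas he).comp_symm_deriv hz
  let A : (Fin n → ℂ) →L[ℂ] (Fin n → ℂ) :=
    mfderiv 𝓘(ℂ, Fin n → ℂ) 𝓘(ℂ, Fin n → ℂ) e (e.symm z)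
  have hcomp : A.comp (chartSymmDeriv e z) = ContinuousLinearMap.id ℂ (Fin n → ℂ) := hid
  have hdet : LinearMap.det ((A : (Fin n → ℂ) →ₗ[ℂ] (Fin n → ℂ)) ∘ₗ
      (chartSymmDeriv e z : (Fin n → ℂ) →ₗ[ℂ] (Fin n → ℂ))) = LinearMap.det LinearMap.id :=
    congrArg (fun B : (Fin n → ℂ) →L[ℂ] (Fin n → ℂ) => B.det) hcomp
  rw [LinearMap.det_comp, LinearMap.det_id] at hdet
  exact right_ne_zero_of_mul_eq_one hdet

theorem chartCoeff_eq_zero_iff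
    (he : e ∈ IsManifold.maximalAtlas 𝓘(ℂ, Fin n → ℂ) ω Ω) {z : Fin n → ℂ} (hz : z ∈ e.target)
    {α : FormField n Ω E} : chartCoeff e α z = 0 ↔ covectorCoeff α (e.symm z) = 0 := by
  rw [chartCoeff_eq, smul_eq_zero, or_iff_right (chartJacobian_ne_zero he hz)]

theorem covectorCoeff_eq
    (he : e ∈ IsManifold.maximalAtlas 𝓘(ℂ, Fin n → ℂ) ω Ω) {x : Ω} (hx : x ∈ e.source)
    (α : FormField n Ω E) :
    covectorCoeff α x = (chartJacobian e (e x))⁻¹ • chartCoeff e α (e x) := by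
  rw [chartCoeff_eq, e.left_inv hx, inv_smul_smul₀ (chartJacobian_ne_zero he (e.map_source hx))]

theorem differentiableAt_transition
    (he : e ∈ IsManifold.maximalAtlas 𝓘(ℂ, Fin n → ℂ) ω Ω)
    (he' : e' ∈ IsManifold.maximalAtlas 𝓘(ℂ, Fin n → ℂ) ω Ω) {z : Fin n → ℂ} (hz : z ∈ e.target)
    (hz' : e.symm z ∈ e'.source) : DifferentiableAt ℂ (e' ∘ e.symm) z := by
  rw [← mdifferentiableAt_iff_differentiableAt]
  exact ((mdifferentiable_of_mem_maximalAtlas he').mdifferentiableAt hz').comp z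
    ((mdifferentiable_of_mem_maximalAtlas he).mdifferentiableAt_symm hz)

theorem chartJacobian_transition
    (he : e ∈ IsManifold.maximalAtlas 𝓘(ℂ, Fin n → ℂ) ω Ω)
    (he' : e' ∈ IsManifold.maximalAtlas 𝓘(ℂ, Fin n → ℂ) ω Ω) {z : Fin n → ℂ} (hz : z ∈ e.target)
    (hz' : e.symm z ∈ e'.source) :
    chartJacobian e z = (fderiv ℂ (e' ∘ e.symm) z).det * chartJacobian e' (e' (e.symm z)) := by
  have hd := differentiableAt_transition he he' hz hz'
  have hev : e.symm =ᶠ[𝓝 z] e'.symm ∘ (e' ∘ e.symm) := by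
    have : ∀ᶠ w in 𝓝 z, e.symm w ∈ e'.source :=
      (e.continuousAt_symm hz).eventually_mem (e'.open_source.mem_nhds hz')
    filter_upwards [this] with w hw
    exact (e'.left_inv hw).symm
  have hcongr : mfderiv 𝓘(ℂ, Fin n → ℂ) 𝓘(ℂ, Fin n → ℂ) e.symm z =
      mfderiv 𝓘(ℂ, Fin n → ℂ) 𝓘(ℂ, Fin n → ℂ) (e'.symm ∘ (e' ∘ e.symm)) z := hev.mfderiv_eq
  have hchain := mfderiv_comp z
    ((mdifferentiable_of_mem_maximalAtlas he').mdifferentiableAt_symm (e'.map_source hz'))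
    (mdifferentiableAt_iff_differentiableAt.2 hd)
  rw [mfderiv_eq_fderiv] at hchain
  have hcomp : chartSymmDeriv e z =
      (chartSymmDeriv e' (e' (e.symm z))).comp (fderiv ℂ (e' ∘ e.symm) z) := hcongr.trans hchain
  rw [chartJacobian, hcomp, mul_comm]
  exact LinearMap.det_comp _ _

theorem chartCoeff_transition
    (he : e ∈ IsManifold.maximalAtlas 𝓘(ℂ, Fin n → ℂ) ω Ω)
    (he' : e' ∈ IsManifold.maximalAtlas 𝓘(ℂ, Fin n → ℂ) ω Ω) {z : Fin n → ℂ} (hz : z ∈ e.target)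
    (hz' : e.symm z ∈ e'.source) (α : FormField n Ω E) :
    chartCoeff e α z =
      (fderiv ℂ (e' ∘ e.symm) z).det • chartCoeff e' α (e' (e.symm z)) := by
  rw [chartCoeff_eq, chartCoeff_eq, chartJacobian_transition he he' hz hz', e'.left_inv hz',
    mul_smul]

variable [IsManifold 𝓘(ℂ, Fin n → ℂ) ω Ω]

theorem eq_zero_of_contMDiff_of_eventually_eq_zero [PreconnectedSpace Ω] {r : Ω → ℂ}
    (hr : ContMDiff 𝓘(ℂ, Fin n → ℂ) 𝓘(ℂ, ℂ) ω r) {p : Ω} (h : ∀ᶠ x in 𝓝 p, r x = 0) :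
    r = 0 := by
  have := eq_univ_of_mem_nhds_of_analytic (X := Fin n → ℂ) (Z := {x | r x = 0}) h
    fun x => ⟨_, analyticOnNhd_comp_symm hr (IsManifold.chart_mem_maximalAtlas x), fun y hy => by
      simp [(chartAt (Fin n → ℂ) x).left_inv hy]⟩
  funext x
  exact this.symm.subset (mem_univ x)

theorem IsAnalyticForm.eq_zero_of_eventually_eq_zero [PreconnectedSpace Ω] {α : FormField n Ω E}
    (hα : IsAnalyticForm α) {p : Ω} (h : ∀ᶠ x in 𝓝 p, covectorCoeff α x = 0) : α = 0 := by
  have := eq_univ_of_mem_nhds_of_analytic (X := Fin n → ℂ) (Z := {x | covectorCoeff α x = 0}) h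
    fun x => ⟨_, hα _ (IsManifold.chart_mem_maximalAtlas x), fun y hy => by
      have he := IsManifold.chart_mem_maximalAtlas (I := 𝓘(ℂ, Fin n → ℂ)) (n := ω) x
      rw [chartCoeff_eq_zero_iff he ((chartAt (Fin n → ℂ) x).map_source hy),
        (chartAt (Fin n → ℂ) x).left_inv hy]
      rfl⟩
  exact eq_of_covectorCoeff_eq fun x => this.symm.subset (mem_univ x)

theorem functionOrder_eq_top_iff [PreconnectedSpace Ω] {r : Ω → ℂ}
    (hr : ContMDiff 𝓘(ℂ, Fin n → ℂ) 𝓘(ℂ, ℂ) ω r) {p : Ω} :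
    functionOrder (n := n) p r = ⊤ ↔ r = 0 := by
  set e := chartAt (Fin n → ℂ) p
  have hpe : p ∈ e.source := mem_chart_source _ p
  have han := analyticOnNhd_comp_symm hr (IsManifold.chart_mem_maximalAtlas p) (e p)
    (e.map_source hpe)
  rw [functionOrder, orderOfZero_eq_top_iff_eventuallyEq han]
  refine ⟨fun h => eq_zero_of_contMDiff_of_eventually_eq_zero hr (p := p) ?_, fun h => by
    rw [h]; exact Eventually.of_forall fun _ => rfl⟩
  filter_upwards [(e.continuousAt hpe).eventually h, e.open_source.mem_nhds hpe] with x hx hxe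
  rw [← e.left_inv hxe]
  exact hx

theorem formOrder_eq_top_iff [PreconnectedSpace Ω] [CompleteSpace E] {α : FormField n Ω E}
    (hα : IsAnalyticForm α) {p : Ω} : formOrder p α = ⊤ ↔ α = 0 := by
  have hmem := IsManifold.chart_mem_maximalAtlas (I := 𝓘(ℂ, Fin n → ℂ)) (n := ω) p
  set e := chartAt (Fin n → ℂ) p
  have hpe : p ∈ e.source := mem_chart_source _ p
  rw [formOrder, orderOfZero_eq_top_iff_eventuallyEq (hα e hmem (e p) (e.map_source hpe))]
  refine ⟨fun h => hα.eq_zero_of_eventually_eq_zero (p := p) ?_, fun h => by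
    rw [h]; exact Eventually.of_forall fun _ => rfl⟩
  filter_upwards [(e.continuousAt hpe).eventually h, e.open_source.mem_nhds hpe] with x hx hxe
  have := (chartCoeff_eq_zero_iff hmem (e.map_source hxe)).1 hx
  rwa [e.left_inv hxe] at this

end Manifold

section Topology

theorem sigmaCompactSpace_of_locallyFinite_cover {ι X : Type*} [TopologicalSpace X]
    [ConnectedSpace X] {v : ι → Set X} (hvo : ∀ i, IsOpen (v i)) (hvf : LocallyFinite v)
    (hvc : ∀ i, IsCompact (closure (v i))) (hvU : ⋃ i, v i = univ) : SigmaCompactSpace X := by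
  let p : X := Classical.arbitrary X
  -- `K (k + 1)` is the union of the closed members of the cover that are adjacent to `K k`.
  let K : ℕ → Set X := fun k => Nat.rec {p}
    (fun _ L => ⋃ i ∈ {i | (v i ∩ L).Nonempty}, closure (v i)) k
  have hK : ∀ k, IsCompact (K k) := by
    intro k
    induction k with
    | zero => exact isCompact_singleton
    | succ k ih =>
      exact (hvf.finite_nonempty_inter_compact ih).isCompact_biUnion fun i _ => hvc i
  have hsub : ∀ k i, (v i ∩ K k).Nonempty → v i ⊆ K (k + 1) := fun k i hi =>
    subset_closure.trans (subset_biUnion_of_mem (u := fun i => closure (v i))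
      (show i ∈ {i | (v i ∩ K k).Nonempty} from hi))
  have hclosed : IsClosed (⋃ k, K k) := isClosed_of_closure_subset fun y hy => by
    obtain ⟨i, hi⟩ := iUnion_eq_univ_iff.1 hvU y
    obtain ⟨w, hwv, hw⟩ := mem_closure_iff.1 hy (v i) (hvo i) hi
    obtain ⟨k, hk⟩ := mem_iUnion.1 hw
    exact mem_iUnion.2 ⟨k + 1, hsub k i ⟨w, hwv, hk⟩ hi⟩
  have hopen : IsOpen (⋃ k, K k) := isOpen_iff_mem_nhds.2 fun y hy => by
    obtain ⟨k, hk⟩ := mem_iUnion.1 hy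
    obtain ⟨i, hi⟩ := iUnion_eq_univ_iff.1 hvU y
    exact mem_of_superset ((hvo i).mem_nhds hi)
      ((hsub k i ⟨y, hi, hk⟩).trans (subset_iUnion K (k + 1)))
  exact ⟨K, hK, IsClopen.eq_univ ⟨hclosed, hopen⟩ ⟨p, mem_iUnion.2 ⟨0, rfl⟩⟩⟩

theorem sigmaCompactSpace_of_paracompact_of_connected (X : Type*) [TopologicalSpace X] [T2Space X]
    [ParacompactSpace X] [ConnectedSpace X] [WeaklyLocallyCompactSpace X] :
    SigmaCompactSpace X := by
  choose C hC hCn using fun x : X => exists_compact_mem_nhds x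
  obtain ⟨v, hvo, hvU, hvf, hvs⟩ := precise_refinement (fun x => interior (C x))
    (fun x => isOpen_interior)
    (iUnion_eq_univ_iff.2 fun x => ⟨x, mem_interior_iff_mem_nhds.2 (hCn x)⟩)
  exact sigmaCompactSpace_of_locallyFinite_cover hvo hvf (fun x =>
    (hC x).of_isClosed_subset isClosed_closure
      (closure_minimal ((hvs x).trans interior_subset) (hC x).isClosed)) hvU

theorem exists_iUnion_chartAt_source_eq_univ (H X : Type*) [TopologicalSpace H]
    [TopologicalSpace X] [SigmaCompactSpace X] [Nonempty X] [ChartedSpace H X] :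
    ∃ x : ℕ → X, ⋃ i, (chartAt H (x i)).source = univ := by
  obtain ⟨s, hs, hU⟩ := countable_cover_nhds_of_sigmaCompact
    (f := fun x : X => (chartAt H x).source) fun x => chart_source_mem_nhds H x
  have hne : s.Nonempty := by
    by_contra! h
    simp [h, empty_ne_univ] at hU
  obtain ⟨x, rfl⟩ := hs.exists_eq_range hne
  exact ⟨x, by simpa using hU⟩

end Topology

/-! ### The measure of a form in local coordinates -/

section BorelSpace

variable {X Y : Type*} [TopologicalSpace X] [MeasurableSpace X] [TopologicalSpace Y]
  [MeasurableSpace Y] [BorelSpace Y]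

theorem measurableSet_inter_preimage_of_continuousOn [OpensMeasurableSpace X] {f : X → Y}
    {s : Set X} {t : Set Y} (hf : ContinuousOn f s) (hs : MeasurableSet s)
    (ht : MeasurableSet t) : MeasurableSet (s ∩ f ⁻¹' t) := by
  rw [← Subtype.image_preimage_coe]
  exact hs.subtype_image ((continuousOn_iff_continuous_domRestrict.1 hf).measurable ht)

theorem lintegral_map_openPartialHomeomorph [BorelSpace X] (e : OpenPartialHomeomorph X Y)
    {ν : Measure X} (hν : ν.restrict e.source = ν) (g : Y → ℝ≥0∞) :
    ∫⁻ y, g y ∂(ν.map e) = ∫⁻ x, g (e x) ∂ν := by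
  have hval := MeasurableEmbedding.subtype_coe e.open_source.measurableSet
  have hemb : MeasurableEmbedding (e ∘ Subtype.val : e.source → Y) :=
    e.isOpenEmbedding_restrict.measurableEmbedding
  have hmap : (ν.comap (Subtype.val : e.source → X)).map Subtype.val = ν := by
    rw [map_comap_subtype_coe e.open_source.measurableSet, hν]
  have hmeas : AEMeasurable e ((ν.comap (Subtype.val : e.source → X)).map Subtype.val) := by
    rw [hmap, ← hν]
    exact e.continuousOn.aemeasurable e.open_source.measurableSet
  conv_lhs => rw [← hmap]
  rw [AEMeasurable.map_map_of_aemeasurable hmeas hval.measurable.aemeasurable, hemb.lintegral_map]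
  conv_rhs => rw [← hmap, hval.lintegral_map]
  rfl

end BorelSpace

section ChartMeasure

variable {n : ℕ} {Ω : Type*} [TopologicalSpace Ω] [ChartedSpace (Fin n → ℂ) Ω]
  {E : Type*} [NormedAddCommGroup E] [InnerProductSpace ℂ E] (S : ConjInvolution E)
  {α : FormField n Ω E} {e e' : OpenPartialHomeomorph Ω (Fin n → ℂ)}

theorem ofReal_density_inChart (e : OpenPartialHomeomorph Ω (Fin n → ℂ)) (α : FormField n Ω E)
    (z : Fin n → ℂ) :
    ENNReal.ofReal (S.density (inChart e α z)).re = ‖chartCoeff e α z‖ₑ ^ 2 := by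
  rw [S.density_eq, Complex.ofReal_re, ENNReal.ofReal_pow (norm_nonneg _), ofReal_norm]
  rfl

variable [MeasurableSpace Ω]

theorem chartMeasure_le_formMeasure (α : FormField n Ω E)
    (he : e ∈ IsManifold.maximalAtlas 𝓘(ℂ, Fin n → ℂ) ω Ω) :
    chartMeasure S α e ≤ formMeasure S α :=
  le_iSup₂ (f := fun e (_ : e ∈ IsManifold.maximalAtlas 𝓘(ℂ, Fin n → ℂ) ω Ω) =>
    chartMeasure S α e) e he

variable [BorelSpace Ω]

theorem lintegral_chartMeasure (he : e ∈ IsManifold.maximalAtlas 𝓘(ℂ, Fin n → ℂ) ω Ω)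
    (hα : IsAnalyticForm α) (g : Ω → ℝ≥0∞) :
    ∫⁻ x, g x ∂(chartMeasure S α e) =
      ∫⁻ z in e.target, ‖chartCoeff e α z‖ₑ ^ 2 * g (e.symm z) := by
  simp only [chartMeasure, ofReal_density_inChart]
  have hm : AEMeasurable (fun z => ‖chartCoeff e α z‖ₑ ^ 2) (volume.restrict e.target) :=
    ((hα e he).continuousOn.enorm.aemeasurable e.open_target.measurableSet).pow_const 2
  rw [lintegral_map_openPartialHomeomorph e.symm,
    lintegral_withDensity_eq_lintegral_mul_non_measurable₀ _ hm]
  · rfl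
  · exact Eventually.of_forall fun z => ENNReal.pow_lt_top enorm_lt_top
  · rw [e.symm_source, restrict_withDensity e.open_target.measurableSet,
      Measure.restrict_restrict e.open_target.measurableSet, inter_self]

theorem setLIntegral_chartMeasure (he : e ∈ IsManifold.maximalAtlas 𝓘(ℂ, Fin n → ℂ) ω Ω)
    (hα : IsAnalyticForm α) {s : Set Ω} (hs : MeasurableSet s) (g : Ω → ℝ≥0∞) :
    ∫⁻ x in s, g x ∂(chartMeasure S α e) =
      ∫⁻ z in e.target ∩ e.symm ⁻¹' s, ‖chartCoeff e α z‖ₑ ^ 2 * g (e.symm z) := by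
  have ht := e.open_target.measurableSet
  rw [← lintegral_indicator hs, lintegral_chartMeasure S he hα, ← lintegral_indicator
    (measurableSet_inter_preimage_of_continuousOn e.continuousOn_symm ht hs),
    ← lintegral_indicator ht]
  refine lintegral_congr fun z => ?_
  by_cases hzt : z ∈ e.target <;> by_cases hzs : e.symm z ∈ s <;> simp [hzt, hzs]

theorem chartMeasure_apply (he : e ∈ IsManifold.maximalAtlas 𝓘(ℂ, Fin n → ℂ) ω Ω)
    (hα : IsAnalyticForm α) {s : Set Ω} (hs : MeasurableSet s) :
    chartMeasure S α e s = ∫⁻ z in e.target ∩ e.symm ⁻¹' s, ‖chartCoeff e α z‖ₑ ^ 2 := by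
  simpa using setLIntegral_chartMeasure S he hα hs 1

theorem ofReal_abs_det_restrictScalars (A : (Fin n → ℂ) →L[ℂ] (Fin n → ℂ)) :
    ENNReal.ofReal |(A.restrictScalars ℝ).det| = ‖A.det‖ₑ ^ 2 := by
  have hdet : (A.restrictScalars ℝ).det = ‖A.det‖ ^ 2 := by
    have := LinearMap.det_restrictScalars (R := ℝ) (f := (A : (Fin n → ℂ) →ₗ[ℂ] (Fin n → ℂ)))
    rw [Algebra.norm_complex_apply, Complex.normSq_eq_norm_sq] at this
    exact this
  rw [hdet, abs_of_nonneg (by positivity), ENNReal.ofReal_pow (norm_nonneg _), ofReal_norm]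

theorem image_transition_target_inter_preimage {X Y Z : Type*} [TopologicalSpace X]
    [TopologicalSpace Y] [TopologicalSpace Z] {e : OpenPartialHomeomorph X Y}
    {e' : OpenPartialHomeomorph X Z} {s : Set X} (hse : s ⊆ e.source) (hse' : s ⊆ e'.source) :
    (e' ∘ e.symm) '' (e.target ∩ e.symm ⁻¹' s) = e'.target ∩ e'.symm ⁻¹' s := by
  ext w
  constructor
  · rintro ⟨z, ⟨-, hzs⟩, rfl⟩
    have hzs' : e.symm z ∈ s := hzs
    exact ⟨e'.map_source (hse' hzs'), by simpa [e'.left_inv (hse' hzs')] using hzs'⟩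
  · rintro ⟨hw, hws⟩
    have hws' : e'.symm w ∈ s := hws
    refine ⟨e (e'.symm w), ⟨e.map_source (hse hws'), ?_⟩, ?_⟩
    · simpa [e.left_inv (hse hws')] using hws'
    · simp [e.left_inv (hse hws'), e'.right_inv hw]

theorem chartMeasure_congr (he : e ∈ IsManifold.maximalAtlas 𝓘(ℂ, Fin n → ℂ) ω Ω)
    (he' : e' ∈ IsManifold.maximalAtlas 𝓘(ℂ, Fin n → ℂ) ω Ω) (hα : IsAnalyticForm α) {s : Set Ω}
    (hs : MeasurableSet s) (hse : s ⊆ e.source) (hse' : s ⊆ e'.source) :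
    chartMeasure S α e s = chartMeasure S α e' s := by
  rw [chartMeasure_apply S he hα hs, chartMeasure_apply S he' hα hs]
  set A := e.target ∩ e.symm ⁻¹' s
  have hA : MeasurableSet A := measurableSet_inter_preimage_of_continuousOn e.continuousOn_symm
    e.open_target.measurableSet hs
  have hinj : InjOn (e' ∘ e.symm) A := e'.injOn.comp (e.symm.injOn.mono fun z hz => hz.1)
    fun z hz => hse' hz.2
  have hderiv : ∀ z ∈ A, HasFDerivWithinAt (e' ∘ e.symm)
      ((fderiv ℂ (e' ∘ e.symm) z).restrictScalars ℝ) A z := fun z hz =>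
    ((differentiableAt_transition he he' hz.1 (hse' hz.2)).hasFDerivAt.restrictScalars
      ℝ).hasFDerivWithinAt
  rw [← image_transition_target_inter_preimage hse hse',
    lintegral_image_eq_lintegral_abs_det_fderiv_mul volume hA hderiv hinj]
  refine setLIntegral_congr_fun hA fun z hz => ?_
  rw [ofReal_abs_det_restrictScalars, chartCoeff_transition he he' hz.1 (hse' hz.2), enorm_smul,
    mul_pow]
  rfl

theorem chartMeasure_le_of_subset_source (he : e ∈ IsManifold.maximalAtlas 𝓘(ℂ, Fin n → ℂ) ω Ω)
    (he' : e' ∈ IsManifold.maximalAtlas 𝓘(ℂ, Fin n → ℂ) ω Ω) (hα : IsAnalyticForm α) {s : Set Ω}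
    (hs : MeasurableSet s) (hse : s ⊆ e.source) :
    chartMeasure S α e' s ≤ chartMeasure S α e s := by
  have hm := hs.inter e'.open_source.measurableSet
  have hpre : e'.target ∩ e'.symm ⁻¹' s = e'.target ∩ e'.symm ⁻¹' (s ∩ e'.source) := by
    ext z
    simp +contextual
  calc chartMeasure S α e' s = chartMeasure S α e' (s ∩ e'.source) := by
        rw [chartMeasure_apply S he' hα hs, chartMeasure_apply S he' hα hm, hpre]
    _ = chartMeasure S α e (s ∩ e'.source) :=
        chartMeasure_congr S he' he hα hm inter_subset_right (inter_subset_left.trans hse)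
    _ ≤ chartMeasure S α e s := measure_mono inter_subset_left

theorem setLIntegral_enorm_sq_chartCoeff (he : e ∈ IsManifold.maximalAtlas 𝓘(ℂ, Fin n → ℂ) ω Ω)
    (he' : e' ∈ IsManifold.maximalAtlas 𝓘(ℂ, Fin n → ℂ) ω Ω) (hα : IsAnalyticForm α)
    {B : Set (Fin n → ℂ)} (hB : MeasurableSet B) (hBe : B ⊆ e.target)
    (hBe' : B ⊆ e.symm ⁻¹' e'.source) :
    ∫⁻ z in B, ‖chartCoeff e α z‖ₑ ^ 2 = chartMeasure S α e' (e.source ∩ e ⁻¹' B) := by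
  have hV : MeasurableSet (e.source ∩ e ⁻¹' B) := measurableSet_inter_preimage_of_continuousOn
    e.continuousOn e.open_source.measurableSet hB
  have hVe' : e.source ∩ e ⁻¹' B ⊆ e'.source := fun x hx => by
    simpa only [mem_preimage, e.left_inv hx.1] using hBe' hx.2
  have hVB : e.target ∩ e.symm ⁻¹' (e.source ∩ e ⁻¹' B) = B := by
    ext w
    constructor
    · rintro ⟨hw, -, hb⟩
      rwa [mem_preimage, e.right_inv hw] at hb
    · intro hw
      exact ⟨hBe hw, e.map_target (hBe hw), by rwa [mem_preimage, e.right_inv (hBe hw)]⟩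
  rw [← chartMeasure_congr S he he' hα hV inter_subset_left hVe', chartMeasure_apply S he hα hV,
    hVB]

theorem ofReal_mul_chartMeasure_le_weightedNormSq {k : Ω → ℝ} {ε : ℝ}
    (he : e ∈ IsManifold.maximalAtlas 𝓘(ℂ, Fin n → ℂ) ω Ω)
    (hk : ∀ᵐ z ∂(volume.restrict e.target), ε ≤ k (e.symm z)) (hα : IsAnalyticForm α) (V : Set Ω) :
    ENNReal.ofReal ε * chartMeasure S α e V ≤ weightedNormSq S k α :=
  calc ENNReal.ofReal ε * chartMeasure S α e V
      ≤ ENNReal.ofReal ε * chartMeasure S α e univ := by gcongr; exact subset_univ V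
    _ = ∫⁻ z in e.target, ENNReal.ofReal ε * ‖chartCoeff e α z‖ₑ ^ 2 := by
        rw [chartMeasure_apply S he hα .univ, preimage_univ, inter_univ,
          lintegral_const_mul' _ _ ENNReal.ofReal_ne_top]
    _ ≤ ∫⁻ z in e.target, ‖chartCoeff e α z‖ₑ ^ 2 * ENNReal.ofReal (k (e.symm z)) := by
        refine lintegral_mono_ae ?_
        filter_upwards [hk] with z hz
        rw [mul_comm]
        gcongr
    _ = ∫⁻ x, ENNReal.ofReal (k x) ∂(chartMeasure S α e) :=
        (lintegral_chartMeasure S he hα fun x => ENNReal.ofReal (k x)).symm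
    _ ≤ weightedNormSq S k α := lintegral_mono' (chartMeasure_le_formMeasure S α he) le_rfl

theorem exists_enorm_sq_chartCoeff_le [CompleteSpace E] {k : Ω → ℝ}
    (hk : IsAdmissibleWeight n k) (he : e ∈ IsManifold.maximalAtlas 𝓘(ℂ, Fin n → ℂ) ω Ω)
    {z₀ : Fin n → ℂ} (hz₀ : z₀ ∈ e.target) :
    ∃ ρ > 0, Metric.ball z₀ ρ ⊆ e.target ∧ ∃ C : ℝ≥0, ∀ α : FormField n Ω E, IsAnalyticForm α →
      ∀ z ∈ Metric.ball z₀ ρ, ‖chartCoeff e α z‖ₑ ^ 2 ≤ C * weightedNormSq S k α := by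
  obtain ⟨e', he', hae', -, ε, hε, hbound⟩ := hk.bounded_below (e.symm z₀)
  obtain ⟨ρ, hρ, hball⟩ := Metric.isOpen_iff.1 (e.symm.isOpen_inter_preimage e'.open_source) z₀
    ⟨hz₀, hae'⟩
  have hρ' : 0 < ρ / 2 := half_pos hρ
  have hsub : ∀ z ∈ Metric.ball z₀ (ρ / 2),
      Metric.ball z (ρ / 2) ⊆ e.target ∩ e.symm ⁻¹' e'.source := fun z hz =>
    (Metric.ball_subset_ball' (by linarith [Metric.mem_ball.1 hz])).trans hball
  set D := ENNReal.ofReal ε * volume (Metric.ball z₀ (ρ / 2))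
  have hD : D ≠ 0 := mul_ne_zero (by simpa using hε) (Metric.measure_ball_pos _ _ hρ').ne'
  have hD' : D ≠ ⊤ := ENNReal.mul_ne_top ENNReal.ofReal_ne_top measure_ball_lt_top.ne
  refine ⟨ρ / 2, hρ', fun z hz => (hsub z hz (Metric.mem_ball_self hρ')).1, D⁻¹.toNNReal,
    fun α hα z hz => ?_⟩
  rw [ENNReal.coe_toNNReal (ENNReal.inv_ne_top.2 hD), mul_comm, ← div_eq_mul_inv,
    ENNReal.le_div_iff_mul_le (Or.inl hD) (Or.inl hD')]
  calc ‖chartCoeff e α z‖ₑ ^ 2 * D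
      = ENNReal.ofReal ε * (‖chartCoeff e α z‖ₑ ^ 2 * volume (Metric.ball z (ρ / 2))) := by
        rw [Measure.addHaar_ball_center, ← Measure.addHaar_ball_center volume z₀]
        exact mul_left_comm _ _ _
    _ ≤ ENNReal.ofReal ε * ∫⁻ w in Metric.ball z (ρ / 2), ‖chartCoeff e α w‖ₑ ^ 2 := by
        gcongr
        exact enorm_sq_mul_volume_ball_le hρ'
          ((hα e he).mono fun w hw => (hsub z hz hw).1)
    _ = ENNReal.ofReal ε *
          chartMeasure S α e' (e.source ∩ e ⁻¹' Metric.ball z (ρ / 2)) := by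
        rw [setLIntegral_enorm_sq_chartCoeff S he he' hα measurableSet_ball
          (fun w hw => (hsub z hz hw).1) fun w hw => (hsub z hz hw).2]
    _ ≤ weightedNormSq S k α :=
        ofReal_mul_chartMeasure_le_weightedNormSq S he' (hbound.mono fun _ => le_of_lt) hα _

end ChartMeasure

/-! ### The norm controls the coefficients and their derivatives -/

section UniformConvergence

variable {X F : Type*} [SeminormedAddCommGroup F] {s : Set X}

theorem tendstoUniformlyOn_of_norm_sub_le {ι : Type*} {l : Filter ι} {f : ι → X → F} {g : X → F}
    {u : ι → ℝ} (h : ∀ i, ∀ x ∈ s, ‖f i x - g x‖ ≤ u i) (hu : Tendsto u l (𝓝 0)) :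
    TendstoUniformlyOn f g l s := by
  refine Metric.tendstoUniformlyOn_iff.2 fun ε hε => ?_
  filter_upwards [hu.eventually_lt_const hε] with i hi x hx
  rw [dist_comm, dist_eq_norm]
  exact (h i x hx).trans_lt hi

theorem uniformCauchySeqOn_of_norm_sub_le {Y : Type*} [PseudoMetricSpace Y] {f : ℕ → X → F}
    {a : ℕ → Y} {C : ℝ} (h : ∀ i j, ∀ x ∈ s, ‖f i x - f j x‖ ≤ C * dist (a i) (a j))
    (ha : CauchySeq a) : UniformCauchySeqOn f atTop s := by
  rw [SeminormedAddGroup.uniformCauchySeqOn_iff_tendstoUniformlyOn_zero, prod_atTop_atTop_eq]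
  refine tendstoUniformlyOn_of_norm_sub_le (u := fun i => C * dist (a i.1) (a i.2))
    (fun i x hx => ?_) ?_
  · simpa [neg_add_eq_sub, dist_comm] using h i.2 i.1 x hx
  · simpa using (cauchySeq_iff_tendsto_dist_atTop_0.1 ha).const_mul C

end UniformConvergence

section Estimates

variable {n : ℕ} {Ω : Type*} [TopologicalSpace Ω] [ChartedSpace (Fin n → ℂ) Ω]
  [MeasurableSpace Ω] [BorelSpace Ω]
  {E : Type*} [NormedAddCommGroup E] [InnerProductSpace ℂ E] [CompleteSpace E]
  (S : ConjInvolution E) {k : Ω → ℝ} {e : OpenPartialHomeomorph Ω (Fin n → ℂ)}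

theorem exists_norm_chartCoeff_le (hk : IsAdmissibleWeight n k)
    (he : e ∈ IsManifold.maximalAtlas 𝓘(ℂ, Fin n → ℂ) ω Ω) {z₀ : Fin n → ℂ} (hz₀ : z₀ ∈ e.target) :
    ∃ ρ > 0, Metric.ball z₀ ρ ⊆ e.target ∧ ∃ C : ℝ,
      ∀ α ∈ bergmanSpace (n := n) S k, ∀ z ∈ Metric.ball z₀ ρ,
        ‖chartCoeff e α z‖ ≤ C * √(weightedNormSq S k α).toReal := by
  obtain ⟨ρ, hρ, hball, C, hC⟩ := exists_enorm_sq_chartCoeff_le S hk he hz₀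
  refine ⟨ρ, hρ, hball, √C, fun α hα z hz => ?_⟩
  have hsq := ENNReal.toReal_mono (ENNReal.mul_ne_top ENNReal.coe_ne_top hα.2.ne) (hC α hα.1 z hz)
  rw [ENNReal.toReal_pow, toReal_enorm, ENNReal.toReal_mul, ENNReal.coe_toReal] at hsq
  rw [← Real.sqrt_mul (NNReal.coe_nonneg C)]
  exact Real.le_sqrt_of_sq_le hsq

theorem exists_norm_chartCoeff_le_of_isCompact (hk : IsAdmissibleWeight n k)
    (he : e ∈ IsManifold.maximalAtlas 𝓘(ℂ, Fin n → ℂ) ω Ω) {K : Set (Fin n → ℂ)}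
    (hKe : K ⊆ e.target) (hK : IsCompact K) :
    ∃ C : ℝ, ∀ α ∈ bergmanSpace (n := n) S k, ∀ z ∈ K,
      ‖chartCoeff e α z‖ ≤ C * √(weightedNormSq S k α).toReal := by
  refine hK.induction_on (p := fun K => ∃ C : ℝ, ∀ α ∈ bergmanSpace (n := n) S k, ∀ z ∈ K,
    ‖chartCoeff e α z‖ ≤ C * √(weightedNormSq S k α).toReal) ⟨0, by simp⟩ ?_ ?_ ?_
  · rintro s t hst ⟨C, hC⟩
    exact ⟨C, fun α hα z hz => hC α hα z (hst hz)⟩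
  · rintro s t ⟨C, hC⟩ ⟨D, hD⟩
    refine ⟨max C D, fun α hα z hz => ?_⟩
    rcases hz with hz | hz
    · exact (hC α hα z hz).trans (by gcongr; exact le_max_left _ _)
    · exact (hD α hα z hz).trans (by gcongr; exact le_max_right _ _)
  · intro z hz
    obtain ⟨ρ, hρ, -, hC⟩ := exists_norm_chartCoeff_le S hk he (hKe hz)
    exact ⟨_, mem_nhdsWithin_of_mem_nhds (Metric.ball_mem_nhds z hρ), hC⟩

theorem exists_norm_iteratedFDeriv_chartCoeff_le (hk : IsAdmissibleWeight n k)
    (he : e ∈ IsManifold.maximalAtlas 𝓘(ℂ, Fin n → ℂ) ω Ω) {z : Fin n → ℂ}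
    (hz : z ∈ e.target) (m : ℕ) :
    ∃ C : ℝ, ∀ α ∈ bergmanSpace (n := n) S k,
      ‖iteratedFDeriv ℂ m (chartCoeff e α) z‖ ≤ C * √(weightedNormSq S k α).toReal := by
  obtain ⟨ρ, hρ, hball, C, hC⟩ := exists_norm_chartCoeff_le S hk he hz
  refine ⟨C * (2 / ρ * (m + 1)) ^ m, fun α hα => ?_⟩
  rw [mul_right_comm]
  exact norm_iteratedFDeriv_center_le hρ ((hα.1 e he).mono hball) (hC α hα) m

end Estimates

section CovectorCoeff

variable {n : ℕ} {Ω : Type*} [TopologicalSpace Ω] [ChartedSpace (Fin n → ℂ) Ω]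
  [MeasurableSpace Ω] [BorelSpace Ω] [IsManifold 𝓘(ℂ, Fin n → ℂ) ω Ω]
  {E : Type*} [NormedAddCommGroup E] [InnerProductSpace ℂ E] [CompleteSpace E]

theorem exists_norm_covectorCoeff_le (S : ConjInvolution E) {k : Ω → ℝ}
    (hk : IsAdmissibleWeight n k) (x : Ω) :
    ∃ C : ℝ, ∀ α ∈ bergmanSpace (n := n) S k,
      ‖covectorCoeff α x‖ ≤ C * √(weightedNormSq S k α).toReal := by
  have he := IsManifold.chart_mem_maximalAtlas (I := 𝓘(ℂ, Fin n → ℂ)) (n := ω) x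
  set e := chartAt (Fin n → ℂ) x
  have hx : x ∈ e.source := mem_chart_source _ x
  obtain ⟨ρ, hρ, -, C, hC⟩ := exists_norm_chartCoeff_le S hk he (e.map_source hx)
  refine ⟨‖(chartJacobian e (e x))⁻¹‖ * C, fun α hα => ?_⟩
  rw [covectorCoeff_eq he hx, norm_smul, mul_assoc]
  gcongr
  exact hC α hα _ (Metric.mem_ball_self hρ)

end CovectorCoeff

/-! ### The Bergman space as a closed subspace of an `L²` space -/

/-- A countable measurable partition of a complex manifold, each part of which lies in the domain of
a chart. -/
structure ChartPartition (n : ℕ) (Ω : Type*) [TopologicalSpace Ω] [ChartedSpace (Fin n → ℂ) Ω]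
    [MeasurableSpace Ω] where
  chart : ℕ → OpenPartialHomeomorph Ω (Fin n → ℂ)
  part : ℕ → Set Ω
  chart_mem : ∀ i, chart i ∈ IsManifold.maximalAtlas 𝓘(ℂ, Fin n → ℂ) ω Ω
  measurableSet_part : ∀ i, MeasurableSet (part i)
  part_subset : ∀ i, part i ⊆ (chart i).source
  disjoint : Pairwise (Function.onFun Disjoint part)
  iUnion_part : ⋃ i, part i = univ

namespace ChartPartition

theorem nonempty (n : ℕ) (Ω : Type*) [TopologicalSpace Ω] [SigmaCompactSpace Ω] [Nonempty Ω]
    [ChartedSpace (Fin n → ℂ) Ω] [IsManifold 𝓘(ℂ, Fin n → ℂ) ω Ω] [MeasurableSpace Ω]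
    [OpensMeasurableSpace Ω] : Nonempty (ChartPartition n Ω) := by
  obtain ⟨x, hx⟩ := exists_iUnion_chartAt_source_eq_univ (Fin n → ℂ) Ω
  exact ⟨{
    chart := fun i => chartAt (Fin n → ℂ) (x i)
    part := disjointed fun i => (chartAt (Fin n → ℂ) (x i)).source
    chart_mem := fun i => IsManifold.chart_mem_maximalAtlas (x i)
    measurableSet_part := fun i => MeasurableSet.disjointed
      (fun i => (chartAt (Fin n → ℂ) (x i)).open_source.measurableSet) i
    part_subset := fun i => disjointed_subset _ i
    disjoint := disjoint_disjointed _
    iUnion_part := by rw [iUnion_disjointed, hx] }⟩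

variable {n : ℕ} {Ω : Type*} [TopologicalSpace Ω] [ChartedSpace (Fin n → ℂ) Ω]
  [MeasurableSpace Ω] {E : Type*} [NormedAddCommGroup E] [InnerProductSpace ℂ E]
  (P : ChartPartition n Ω) (S : ConjInvolution E) {k : Ω → ℝ} {α : FormField n Ω E}

/-- The image of the `i`-th part in the coordinates of the `i`-th chart. -/
def image (i : ℕ) : Set (Fin n → ℂ) :=
  (P.chart i).target ∩ (P.chart i).symm ⁻¹' P.part i

/-- Lebesgue measure with density `k` on the disjoint union of the coordinate images of the
parts. -/
noncomputable def weightMeasure (k : Ω → ℝ) : Measure (ℕ × (Fin n → ℂ)) :=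
  Measure.sum fun i => ((volume.restrict (P.image i)).withDensity fun z =>
    ENNReal.ofReal (k ((P.chart i).symm z))).map (Prod.mk i)

/-- The coefficient function of a form on the disjoint union of the coordinate images. -/
noncomputable def coeff (α : FormField n Ω E) (q : ℕ × (Fin n → ℂ)) : E :=
  chartCoeff (P.chart q.1) α q.2

theorem sum_restrict_part (μ : Measure Ω) : (Measure.sum fun i => μ.restrict (P.part i)) = μ := by
  rw [← Measure.restrict_iUnion P.disjoint P.measurableSet_part, P.iUnion_part,
    Measure.restrict_univ]

theorem lintegral_weightMeasure (hk : IsAdmissibleWeight n k) (g : ℕ × (Fin n → ℂ) → ℝ≥0∞) :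
    ∫⁻ q, g q ∂(P.weightMeasure k) =
      ∑' i, ∫⁻ z in P.image i, g (i, z) * ENNReal.ofReal (k ((P.chart i).symm z)) := by
  rw [weightMeasure, lintegral_sum_measure]
  refine tsum_congr fun i => ?_
  have hweight : AEMeasurable (fun z => ENNReal.ofReal (k ((P.chart i).symm z)))
      (volume.restrict (P.image i)) :=
    ((hk.measurable _ (P.chart_mem i)).ennreal_ofReal).mono_measure
      (Measure.restrict_mono inter_subset_left le_rfl)
  rw [(measurableEmbedding_prodMk_left i).lintegral_map,
    lintegral_withDensity_eq_lintegral_mul_non_measurable₀ _ hweight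
      (Eventually.of_forall fun _ => ENNReal.ofReal_lt_top)]
  exact lintegral_congr fun z => mul_comm _ _

variable [BorelSpace Ω]

theorem formMeasure_eq_sum (hα : IsAnalyticForm α) :
    formMeasure S α = Measure.sum fun i => (chartMeasure S α (P.chart i)).restrict (P.part i) := by
  refine le_antisymm (iSup₂_le fun e he => ?_) ?_
  · refine (P.sum_restrict_part _).symm.trans_le (Measure.le_iff.2 fun s hs => ?_)
    rw [Measure.sum_apply _ hs, Measure.sum_apply _ hs]
    refine ENNReal.tsum_le_tsum fun i => ?_
    rw [Measure.restrict_apply hs, Measure.restrict_apply hs]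
    exact chartMeasure_le_of_subset_source S (P.chart_mem i) he hα
      (hs.inter (P.measurableSet_part i)) (inter_subset_right.trans (P.part_subset i))
  · refine le_of_le_of_eq (Measure.le_iff.2 fun s hs => ?_) (P.sum_restrict_part _)
    rw [Measure.sum_apply _ hs, Measure.sum_apply _ hs]
    exact ENNReal.tsum_le_tsum fun i => Measure.restrict_mono le_rfl
      (chartMeasure_le_formMeasure S α (P.chart_mem i)) s

theorem weightedNormSq_eq_tsum (k : Ω → ℝ) (hα : IsAnalyticForm α) :
    weightedNormSq S k α = ∑' i, ∫⁻ z in P.image i,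
      ‖chartCoeff (P.chart i) α z‖ₑ ^ 2 * ENNReal.ofReal (k ((P.chart i).symm z)) := by
  rw [weightedNormSq, P.formMeasure_eq_sum S hα, lintegral_sum_measure]
  exact tsum_congr fun i =>
    setLIntegral_chartMeasure S (P.chart_mem i) hα (P.measurableSet_part i) _

theorem measurableSet_image (i : ℕ) : MeasurableSet (P.image i) :=
  measurableSet_inter_preimage_of_continuousOn (P.chart i).continuousOn_symm
    (P.chart i).open_target.measurableSet (P.measurableSet_part i)

theorem aestronglyMeasurable_coeff (k : Ω → ℝ) (hα : IsAnalyticForm α) :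
    AEStronglyMeasurable (P.coeff α) (P.weightMeasure k) := by
  refine aestronglyMeasurable_sum_measure_iff.2 fun i => ?_
  rw [(measurableEmbedding_prodMk_left i).aestronglyMeasurable_map_iff]
  refine AEStronglyMeasurable.mono_ac (withDensity_absolutelyContinuous _ _) ?_
  exact ((hα _ (P.chart_mem i)).continuousOn.mono inter_subset_left).aestronglyMeasurable
    (P.measurableSet_image i)

theorem eLpNorm_coeff (hk : IsAdmissibleWeight n k) (hα : IsAnalyticForm α) :
    eLpNorm (P.coeff α) 2 (P.weightMeasure k) ^ 2 = weightedNormSq S k α := by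
  have hpow := eLpNorm_nnreal_pow_eq_lintegral (μ := P.weightMeasure k) (f := P.coeff α) (p := 2)
    two_ne_zero
  simp only [NNReal.coe_ofNat, ENNReal.rpow_ofNat, ENNReal.coe_ofNat] at hpow
  rw [hpow, P.lintegral_weightMeasure hk, P.weightedNormSq_eq_tsum S k hα]
  rfl

theorem memLp_coeff_iff (hk : IsAdmissibleWeight n k) (hα : IsAnalyticForm α) :
    MemLp (P.coeff α) 2 (P.weightMeasure k) ↔ weightedNormSq S k α < ⊤ := by
  rw [MemLp, and_iff_right (P.aestronglyMeasurable_coeff k hα), ← P.eLpNorm_coeff S hk hα,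
    ENNReal.pow_lt_top_iff, or_iff_left two_ne_zero]

variable (hk : IsAdmissibleWeight n k)

/-- The isometric embedding of a weighted Bergman space in an `L²` space, which sends a form to its
coefficients with respect to the charts of the partition. -/
noncomputable def toL2 : bergmanSpace (n := n) S k →ₗ[ℂ] Lp E 2 (P.weightMeasure k) where
  toFun α := ((P.memLp_coeff_iff S hk α.2.1).2 α.2.2).toLp (P.coeff (α : FormField n Ω E))
  map_add' _ _ := rfl
  map_smul' _ _ := rfl

theorem coeFn_toL2 (α : bergmanSpace (n := n) S k) :
    P.toL2 S hk α =ᵐ[P.weightMeasure k] P.coeff (α : FormField n Ω E) :=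
  MemLp.coeFn_toLp ((P.memLp_coeff_iff S hk α.2.1).2 α.2.2)

theorem norm_toL2 (α : bergmanSpace (n := n) S k) :
    ‖P.toL2 S hk α‖ = √(weightedNormSq S k (α : FormField n Ω E)).toReal := by
  have hnorm : ‖P.toL2 S hk α‖ =
      (eLpNorm (P.coeff (α : FormField n Ω E)) 2 (P.weightMeasure k)).toReal :=
    Lp.norm_toLp _ ((P.memLp_coeff_iff S hk α.2.1).2 α.2.2)
  rw [hnorm, ← P.eLpNorm_coeff S hk α.2.1, ENNReal.toReal_pow, Real.sqrt_sq ENNReal.toReal_nonneg]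

theorem dist_toL2 (α β : bergmanSpace (n := n) S k) : dist (P.toL2 S hk α) (P.toL2 S hk β) =
      √(weightedNormSq S k (α - β : FormField n Ω E)).toReal := by
  rw [dist_eq_norm, ← map_sub, P.norm_toL2]
  rfl

variable [IsManifold 𝓘(ℂ, Fin n → ℂ) ω Ω] [CompleteSpace E]

theorem toL2_injective : Function.Injective (P.toL2 S hk) := by
  refine (injective_iff_map_eq_zero _).2 fun α hα => ?_
  refine Subtype.ext (eq_of_covectorCoeff_eq fun x => ?_)
  obtain ⟨C, hC⟩ := exists_norm_covectorCoeff_le S hk x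
  have hzero := hC _ α.2
  rw [← P.norm_toL2 S hk, hα, norm_zero, mul_zero, norm_le_zero_iff] at hzero
  rw [hzero]
  rfl

/-- Coefficients converge locally uniformly along a sequence that is Cauchy in norm, so
Weierstrass's theorem makes the pointwise limit analytic. -/
theorem exists_isAnalyticForm_tendsto_chartCoeff {α : ℕ → bergmanSpace (n := n) S k}
    (hα : CauchySeq fun j => P.toL2 S hk (α j)) :
    ∃ β : FormField n Ω E, IsAnalyticForm β ∧
      ∀ e : OpenPartialHomeomorph Ω (Fin n → ℂ), ∀ z,
        Tendsto (fun j => chartCoeff e (α j : FormField n Ω E) z) atTop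
          (𝓝 (chartCoeff e β z)) := by
  have hcoeff : ∀ x, ∃ u : E, Tendsto (fun j => covectorCoeff (α j : FormField n Ω E) x) atTop
      (𝓝 u) := by
    intro x
    obtain ⟨C, hC⟩ := exists_norm_covectorCoeff_le S hk x
    refine cauchySeq_tendsto_of_complete <| (uniformCauchySeqOn_of_norm_sub_le (s := {x}) (C := C)
      (fun i j y hy => ?_) hα).cauchySeq (mem_singleton x)
    rw [mem_singleton_iff.1 hy, P.dist_toL2]
    exact hC _ (α i - α j).2
  choose u hu using hcoeff
  have hlim : ∀ (e : OpenPartialHomeomorph Ω (Fin n → ℂ)) z,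
      Tendsto (fun j => chartCoeff e (α j : FormField n Ω E) z) atTop
        (𝓝 (chartCoeff e (formOfCoeff u) z)) := by
    intro e z
    simp only [chartCoeff_eq, covectorCoeff_formOfCoeff]
    exact (hu _).const_smul _
  refine ⟨formOfCoeff u, fun e he z hz => ?_, hlim⟩
  obtain ⟨ρ, hρ, hball, C, hC⟩ := exists_norm_chartCoeff_le S hk he hz
  have hcauchy : UniformCauchySeqOn (fun j => chartCoeff e (α j : FormField n Ω E)) atTop
      (Metric.ball z ρ) := by
    refine uniformCauchySeqOn_of_norm_sub_le (C := C) (fun i j w hw => ?_) hα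
    rw [P.dist_toL2]
    exact hC _ (α i - α j).2 w hw
  exact analyticAt_of_tendstoUniformlyOn hρ
    (Eventually.of_forall fun j => ((α j).2.1 e he).mono hball)
    (hcauchy.tendstoUniformlyOn_of_tendsto fun w _ => hlim e w)

theorem isClosed_range_toL2 : IsClosed (range (P.toL2 S hk)) := by
  refine IsSeqClosed.isClosed fun a G ha hG => ?_
  choose α hα using ha
  obtain rfl : (fun j => P.toL2 S hk (α j)) = a := funext hα
  obtain ⟨β, hβ, hlim⟩ := P.exists_isAnalyticForm_tendsto_chartCoeff S hk hG.cauchySeq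
  obtain ⟨ns, hns, hae⟩ := (tendstoInMeasure_of_tendsto_Lp hG).exists_seq_tendsto_ae
  have hGβ : G =ᵐ[P.weightMeasure k] P.coeff β := by
    filter_upwards [hae, ae_all_iff.2 fun j => P.coeFn_toL2 S hk (α j)] with q hq hcoeff
    simp only [hcoeff] at hq
    exact tendsto_nhds_unique hq ((hlim _ q.2).comp hns.tendsto_atTop)
  have hmem : MemLp (P.coeff β) 2 (P.weightMeasure k) := (memLp_congr_ae hGβ).1 (Lp.memLp G)
  exact ⟨⟨β, hβ, (P.memLp_coeff_iff S hk hβ).1 hmem⟩,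
    Lp.ext ((MemLp.coeFn_toLp hmem).trans hGβ.symm)⟩

end ChartPartition

/-! ### Multiplication of forms by bounded analytic functions -/

section PointwiseMultiplication

variable {n : ℕ} {Ω : Type*} [TopologicalSpace Ω] [ChartedSpace (Fin n → ℂ) Ω]
  {E : Type*} [NormedAddCommGroup E] [InnerProductSpace ℂ E] {r : Ω → ℂ} {α : FormField n Ω E}

/-- The product of a function and a form, which makes `A²(E, Ω, k)` a module over algebras of
bounded analytic functions. -/
noncomputable def formMul (r : Ω → ℂ) (α : FormField n Ω E) : FormField n Ω E :=
  fun x => r x • α x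

theorem chartCoeff_formMul (e : OpenPartialHomeomorph Ω (Fin n → ℂ)) (r : Ω → ℂ)
    (α : FormField n Ω E) (z : Fin n → ℂ) :
    chartCoeff e (formMul r α) z = r (e.symm z) • chartCoeff e α z := rfl

theorem chartCoeff_zero (e : OpenPartialHomeomorph Ω (Fin n → ℂ)) (z : Fin n → ℂ) :
    chartCoeff e (0 : FormField n Ω E) z = 0 := rfl

theorem IsAnalyticForm.formMul (hr : ContMDiff 𝓘(ℂ, Fin n → ℂ) 𝓘(ℂ, ℂ) ω r)
    (hα : IsAnalyticForm α) : IsAnalyticForm (formMul r α) := fun e he =>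
  (analyticOnNhd_comp_symm hr he).smul (hα e he)

variable [MeasurableSpace Ω] (S : ConjInvolution E)

theorem formMeasure_zero : formMeasure S (0 : FormField n Ω E) = 0 := by
  refine le_antisymm (iSup₂_le fun e _ => ?_) (Measure.zero_le _)
  simp [chartMeasure, ofReal_density_inChart, chartCoeff_zero]

variable [BorelSpace Ω]

theorem weightedNormSq_formMul_le (k : Ω → ℝ) {C : ℝ≥0} (hC : ∀ x, ‖r x‖ ≤ C)
    (hα : IsAnalyticForm α) :
    weightedNormSq S k (formMul r α) ≤ (C ^ 2 : ℝ≥0) * weightedNormSq S k α := by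
  have hle : formMeasure S (formMul r α) ≤ ((C ^ 2 : ℝ≥0) : ℝ≥0∞) • formMeasure S α := by
    have := formMeasure_le S (γ := formMul r α) (β := 0) hα (C ^ 2) fun e z => by
      rw [chartCoeff_formMul, chartCoeff_zero, norm_zero, norm_smul, mul_pow,
        zero_pow two_ne_zero, add_zero, NNReal.coe_pow]
      gcongr
      exact hC _
    rwa [formMeasure_zero, add_zero] at this
  refine (lintegral_mono' hle le_rfl).trans ?_
  rw [lintegral_smul_measure]
  rfl

theorem formMul_mem_bergmanSpace {k : Ω → ℝ} (hr : r ∈ boundedAnalytic n Ω)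
    (hα : α ∈ bergmanSpace (n := n) S k) : formMul r α ∈ bergmanSpace (n := n) S k := by
  obtain ⟨hr, C, hC⟩ := hr
  refine ⟨hα.1.formMul hr, (weightedNormSq_formMul_le S k (C := C.toNNReal)
    (fun x => (hC x).trans (Real.le_coe_toNNReal C)) hα.1).trans_lt ?_⟩
  exact ENNReal.mul_lt_top ENNReal.coe_lt_top hα.2

/-- The pointwise module structure of a weighted Bergman space. It is not an instance because it
depends on `hR`. -/
@[reducible]
noncomputable def bergmanModule (k : Ω → ℝ) {R : Subalgebra ℂ (Ω → ℂ)}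
    (hR : R ≤ boundedAnalytic n Ω) : Module R (bergmanSpace (n := n) (E := E) S k) where
  smul r α := ⟨formMul (r : Ω → ℂ) α, formMul_mem_bergmanSpace S (hR r.2) α.2⟩
  one_smul _ := Subtype.ext (funext fun _ => one_smul _ _)
  mul_smul _ _ _ := Subtype.ext (funext fun _ => mul_smul _ _ _)
  smul_zero _ := Subtype.ext (funext fun _ => smul_zero _)
  smul_add _ _ _ := Subtype.ext (funext fun _ => smul_add _ _ _)
  add_smul _ _ _ := Subtype.ext (funext fun _ => add_smul _ _ _)
  zero_smul _ := Subtype.ext (funext fun _ => zero_smul _ _)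

end PointwiseMultiplication

section FunctionOrder

variable {n : ℕ} {Ω : Type*} [TopologicalSpace Ω] [ChartedSpace (Fin n → ℂ) Ω]

theorem one_le_functionOrder_iff {p : Ω} {r : Ω → ℂ} :
    1 ≤ functionOrder (n := n) p r ↔ r p = 0 := by
  rw [functionOrder, one_le_orderOfZero_iff, Function.comp_apply,
    (chartAt (Fin n → ℂ) p).left_inv (mem_chart_source _ p)]

variable [IsManifold 𝓘(ℂ, Fin n → ℂ) ω Ω]

theorem analyticAt_comp_chartAt_symm {r : Ω → ℂ}
    (hr : ContMDiff 𝓘(ℂ, Fin n → ℂ) 𝓘(ℂ, ℂ) ω r) (p : Ω) :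
    AnalyticAt ℂ (r ∘ (chartAt (Fin n → ℂ) p).symm) (chartAt (Fin n → ℂ) p p) :=
  analyticOnNhd_comp_symm hr (IsManifold.chart_mem_maximalAtlas p) _ (mem_chart_target _ p)

theorem isAlgebraValuation_functionOrder [PreconnectedSpace Ω] {R : Subalgebra ℂ (Ω → ℂ)}
    (hR : ∀ r ∈ R, ContMDiff 𝓘(ℂ, Fin n → ℂ) 𝓘(ℂ, ℂ) ω r) (p : Ω) :
    IsAlgebraValuation fun r : R => functionOrder (n := n) p (r : Ω → ℂ) where
  ord_unit r hr := by
    by_contra hord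
    have hrp : (r : Ω → ℂ) p = 0 :=
      one_le_functionOrder_iff.1 (Order.one_le_iff_ne_zero.2 hord)
    rcases hr with ⟨s, hs⟩ | ⟨s, hs⟩ <;>
      simpa [hrp] using congrArg (fun t : R => (t : Ω → ℂ) p) hs
  ord_eq_top_iff r := by
    rw [functionOrder_eq_top_iff (hR r r.2), ← ZeroMemClass.coe_eq_zero]
  ord_mul r s := orderOfZero_add_le_smul (analyticAt_comp_chartAt_symm (hR r r.2) p)
    (analyticAt_comp_chartAt_symm (hR s s.2) p)
  ord_smul c r hc := orderOfZero_const_smul (analyticAt_comp_chartAt_symm (hR r r.2) p) hc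
  ord_add r s := min_orderOfZero_le_add (analyticAt_comp_chartAt_symm (hR r r.2) p)
    (analyticAt_comp_chartAt_symm (hR s s.2) p)

end FunctionOrder

section UpperSemicontinuity

variable {n : ℕ} {F : Type*} [NormedAddCommGroup F] [NormedSpace ℂ F]

theorem upperSemicontinuous_orderOfZero {H : Type*} [TopologicalSpace H]
    {f : H → (Fin n → ℂ) → F} {z : Fin n → ℂ}
    (hf : ∀ m, Continuous fun h => iteratedFDeriv ℂ m (f h) z) :
    UpperSemicontinuous fun h => orderOfZero (f h) z := by
  intro h y hy
  simp only [orderOfZero, iInf_lt_iff] at hy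
  obtain ⟨m, hm, hmy⟩ := hy
  filter_upwards [(hf m).continuousAt.eventually_ne hm] with g hg
  exact (iInf₂_le m hg).trans_lt hmy

end UpperSemicontinuity

/-! ### Hilbert spaces of analytic forms -/

section BergmanEmbedding

variable {n : ℕ} {Ω : Type*} [TopologicalSpace Ω] [ChartedSpace (Fin n → ℂ) Ω]
  [MeasurableSpace Ω] [BorelSpace Ω]
  {E : Type*} [NormedAddCommGroup E] [InnerProductSpace ℂ E]
  {H : Type*} [NormedAddCommGroup H] [InnerProductSpace ℂ H]

/-- The linear map `ι` identifies the elements of the inner product space `H` with forms in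
`A²(E, Ω, k)`, with the same norm. The properties of `A²(E, Ω, k)` as a Hilbert module are proved
for such an `H`, because the inner product of `A²(E, Ω, k)` itself is not an instance. -/
structure IsBergmanEmbedding (S : ConjInvolution E) (k : Ω → ℝ) (ι : H →ₗ[ℂ] FormField n Ω E) :
    Prop where
  mem_bergmanSpace : ∀ h, ι h ∈ bergmanSpace (n := n) S k
  norm_eq : ∀ h, ‖h‖ = √(weightedNormSq S k (ι h)).toReal

namespace IsBergmanEmbedding

variable {ι : H →ₗ[ℂ] FormField n Ω E} {S : ConjInvolution E} {k : Ω → ℝ}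

theorem injective (hι : IsBergmanEmbedding S k ι) : Function.Injective ι := by
  refine (injective_iff_map_eq_zero ι).2 fun h hh => norm_eq_zero.1 ?_
  simp [hι.norm_eq, hh, weightedNormSq, formMeasure_zero]

theorem norm_sub_eq (hι : IsBergmanEmbedding S k ι) (g h : H) :
    ‖g - h‖ = √(weightedNormSq S k (ι g - ι h)).toReal := by
  rw [hι.norm_eq, map_sub]

variable {R : Subalgebra ℂ (Ω → ℂ)} [Module R H]

theorem isHilbertModule [CompleteSpace H] (hι : IsBergmanEmbedding S k ι)
    (hR : R ≤ boundedAnalytic n Ω)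
    (hmul : ∀ (r : R) (h : H), ι (r • h) = formMul (r : Ω → ℂ) (ι h)) :
    IsHilbertModule R H where
  complete := inferInstance
  smul_assoc c r h := hι.injective <| by
    rw [hmul, map_smul, hmul]
    exact funext fun x => smul_assoc c _ _
  continuous_smul r := by
    obtain ⟨-, C, hC⟩ := hR r.2
    refine AddMonoidHomClass.continuous_of_bound (DistribSMul.toAddMonoidHom H r) C.toNNReal
      fun h => ?_
    have hsq := ENNReal.toReal_mono
      (ENNReal.mul_ne_top ENNReal.coe_ne_top (hι.mem_bergmanSpace h).2.ne)
      (weightedNormSq_formMul_le S k (C := C.toNNReal)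
        (fun x => (hC x).trans (Real.le_coe_toNNReal C)) (hι.mem_bergmanSpace h).1)
    rw [ENNReal.toReal_mul, ENNReal.coe_toReal, NNReal.coe_pow] at hsq
    rw [DistribSMul.toAddMonoidHom_apply, hι.norm_eq, hι.norm_eq, hmul]
    refine (Real.sqrt_le_sqrt hsq).trans_eq ?_
    rw [Real.sqrt_mul (by positivity), Real.sqrt_sq (NNReal.coe_nonneg _)]

variable [CompleteSpace E]

theorem continuous_iteratedFDeriv_chartCoeff (hι : IsBergmanEmbedding S k ι)
    (hk : IsAdmissibleWeight n k) {e : OpenPartialHomeomorph Ω (Fin n → ℂ)}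
    (he : e ∈ IsManifold.maximalAtlas 𝓘(ℂ, Fin n → ℂ) ω Ω) {z : Fin n → ℂ} (hz : z ∈ e.target)
    (m : ℕ) : Continuous fun h : H => iteratedFDeriv ℂ m (chartCoeff e (ι h)) z := by
  obtain ⟨C, hC⟩ := exists_norm_iteratedFDeriv_chartCoeff_le S hk he hz m
  let D := AddMonoidHom.mk' (fun h : H => iteratedFDeriv ℂ m (chartCoeff e (ι h)) z)
    fun g h => by
      rw [map_add, chartCoeff_add]
      exact iteratedFDeriv_add_apply ((hι.mem_bergmanSpace g).1 e he z hz).contDiffAt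
        ((hι.mem_bergmanSpace h).1 e he z hz).contDiffAt
  refine AddMonoidHomClass.continuous_of_bound D C fun h => ?_
  rw [hι.norm_eq]
  exact hC _ (hι.mem_bergmanSpace h)

theorem tendstoUniformlyOn_chartCoeff (hι : IsBergmanEmbedding S k ι)
    (hk : IsAdmissibleWeight n k) {e : OpenPartialHomeomorph Ω (Fin n → ℂ)}
    (he : e ∈ IsManifold.maximalAtlas 𝓘(ℂ, Fin n → ℂ) ω Ω) {K : Set (Fin n → ℂ)}
    (hKe : K ⊆ e.target) (hK : IsCompact K) {J : Type*} {l : Filter J} {h : J → H} {h₀ : H}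
    (hh : Tendsto h l (𝓝 h₀)) :
    TendstoUniformlyOn (fun j => chartCoeff e (ι (h j))) (chartCoeff e (ι h₀)) l K := by
  obtain ⟨C, hC⟩ := exists_norm_chartCoeff_le_of_isCompact S hk he hKe hK
  refine tendstoUniformlyOn_of_norm_sub_le (u := fun j => C * ‖h j - h₀‖) (fun j z hz => ?_) ?_
  · rw [hι.norm_sub_eq, ← map_sub]
    have hsub := hC _ (hι.mem_bergmanSpace (h j - h₀)) z hz
    rw [map_sub] at hsub ⊢
    exact hsub
  · simpa using (tendsto_iff_norm_sub_tendsto_zero.1 hh).const_mul C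

theorem isAnalyticHilbertModuleOfForms [CompleteSpace H] (hι : IsBergmanEmbedding S k ι)
    (hk : IsAdmissibleWeight n k) (hR : R ≤ boundedAnalytic n Ω)
    (hmul : ∀ (r : R) (h : H), ι (r • h) = formMul (r : Ω → ℂ) (ι h)) :
    IsAnalyticHilbertModuleOfForms R ι where
  analytic_algebra _ hr := (hR hr).1
  injective := hι.injective
  analytic_form h := (hι.mem_bergmanSpace h).1
  hilbertModule := hι.isHilbertModule hR hmul
  pointwise r h x := congrFun (hmul r h) x
  uniform_on_compacts _ _ hh _ he _ hKe hK := hι.tendstoUniformlyOn_chartCoeff hk he hKe hK hh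

variable [IsManifold 𝓘(ℂ, Fin n → ℂ) ω Ω] [PreconnectedSpace Ω]

theorem isHilbertModuleValuation_formOrder (hι : IsBergmanEmbedding S k ι)
    (hk : IsAdmissibleWeight n k) (hR : R ≤ boundedAnalytic n Ω)
    (hmul : ∀ (r : R) (h : H), ι (r • h) = formMul (r : Ω → ℂ) (ι h)) (p : Ω) :
    IsHilbertModuleValuation (fun r : R => functionOrder (n := n) p (r : Ω → ℂ))
      (fun h : H => formOrder p (ι h)) := by
  have he := IsManifold.chart_mem_maximalAtlas (I := 𝓘(ℂ, Fin n → ℂ)) (n := ω) p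
  have hp := mem_chart_target (Fin n → ℂ) p
  have han : ∀ h, AnalyticAt ℂ (chartCoeff (chartAt (Fin n → ℂ) p) (ι h))
      (chartAt (Fin n → ℂ) p p) := fun h => (hι.mem_bergmanSpace h).1 _ he _ hp
  refine ⟨fun h => ?_, fun r h => ?_, fun c h hc => ?_, fun g h => ?_, ?_⟩
  · rw [formOrder_eq_top_iff (hι.mem_bergmanSpace h).1, map_eq_zero_iff ι hι.injective]
  · rw [hmul]
    exact orderOfZero_add_le_smul (analyticAt_comp_chartAt_symm (hR r.2).1 p) (han h)
  · rw [map_smul]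
    exact orderOfZero_const_smul (han h) hc
  · rw [map_add]
    exact min_orderOfZero_le_add (han g) (han h)
  · exact upperSemicontinuous_orderOfZero
      (hι.continuous_iteratedFDeriv_chartCoeff hk he hp)

theorem exists_beurlingCharacterization [CompleteSpace H] (hι : IsBergmanEmbedding S k ι)
    (hk : IsAdmissibleWeight n k) (hR : R ≤ boundedAnalytic n Ω)
    (hmul : ∀ (r : R) (h : H), ι (r • h) = formMul (r : Ω → ℂ) (ι h)) (p : Ω) :
    ∃ hv : IsValuationHilbertModule (fun r : R => functionOrder (n := n) p (r : Ω → ℂ))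
      (fun h : H => formOrder p (ι h)), hv.BeurlingCharacterization := by
  refine ⟨⟨isAlgebraValuation_functionOrder (fun r hr => (hR hr).1) p,
    hι.isHilbertModule hR hmul, hι.isHilbertModuleValuation_formOrder hk hR hmul p⟩,
    IsValuationHilbertModule.beurlingCharacterization _ fun r => ⟨(r : Ω → ℂ) p, ?_⟩⟩
  rw [one_le_functionOrder_iff]
  simp [Algebra.algebraMap_eq_smul_one]

end IsBergmanEmbedding

end BergmanEmbedding

section InducedHilbertSpace

variable {V W : Type*} [NormedAddCommGroup W] [InnerProductSpace ℂ W]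

/-- The inner product `⟪T x, T y⟫` pulled back along an injective linear map `T`. Only the linear
structure of `V` is given, since the Bergman space gets its norm from here. -/
@[reducible]
noncomputable def coreOfInjective [AddCommGroup V] [Module ℂ V] (T : V →ₗ[ℂ] W)
    (hT : Function.Injective T) : InnerProductSpace.Core ℂ V where
  inner x y := inner ℂ (T x) (T y)
  conj_inner_symm x y := inner_conj_symm (T x) (T y)
  re_inner_nonneg _ := inner_self_nonneg
  add_left x y z := by rw [map_add, inner_add_left]
  smul_left x y c := by rw [map_smul, inner_smul_left]
  definite x hx := hT (by rw [inner_self_eq_zero.1 hx, map_zero])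

theorem completeSpace_of_isClosed_range [CompleteSpace W] [NormedAddCommGroup V]
    [NormedSpace ℂ V] (T : V →ₗ[ℂ] W) (hT : ∀ x, ‖T x‖ = ‖x‖) (hclosed : IsClosed (range T)) :
    CompleteSpace V :=
  (AddMonoidHomClass.isometry_of_norm T hT).isUniformInducing.completeSpace hclosed.isComplete

end InducedHilbertSpace

theorem polynomialAlgebraOn_le_boundedAnalytic {n : ℕ} {U : TopologicalSpace.Opens (Fin n → ℂ)}
    (hU : Bornology.IsBounded (U : Set (Fin n → ℂ))) :
    polynomialAlgebraOn U ≤ boundedAnalytic n U := by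
  rw [polynomialAlgebraOn, ← Algebra.map_top, ← MvPolynomial.adjoin_range_X, AlgHom.map_adjoin,
    Algebra.adjoin_le_iff]
  rintro - ⟨-, ⟨i, rfl⟩, rfl⟩
  obtain ⟨C, hC⟩ := hU.exists_norm_le
  simp only [MvPolynomial.aeval_X]
  have coord_analytic : ContMDiff 𝓘(ℂ, Fin n → ℂ) 𝓘(ℂ, ℂ) ω fun z : Fin n → ℂ => z i :=
    (contDiff_apply ℂ ℂ i).contMDiff
  exact ⟨coord_analytic.comp contMDiff_subtype_val, C,
    fun z => (norm_le_pi_norm (z : Fin n → ℂ) i).trans (hC z z.2)⟩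

theorem theorem7p5_general {n : ℕ} {Ω : Type*} [TopologicalSpace Ω] [SigmaCompactSpace Ω]
    [PreconnectedSpace Ω] [ChartedSpace (Fin n → ℂ) Ω] [IsManifold 𝓘(ℂ, Fin n → ℂ) ω Ω]
    [MeasurableSpace Ω] [BorelSpace Ω]
    {E : Type*} [NormedAddCommGroup E] [InnerProductSpace ℂ E] [CompleteSpace E]
    (S : ConjInvolution E) (p : Ω) {k : Ω → ℝ} (hk : IsAdmissibleWeight n k)
    {R : Subalgebra ℂ (Ω → ℂ)} (hR : R ≤ boundedAnalytic n Ω) :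
    BergmanSpaceIsBeurlingModule (n := n) S k p R := by
  have : Nonempty Ω := ⟨p⟩
  obtain ⟨P⟩ := ChartPartition.nonempty n Ω
  let core := coreOfInjective (P.toL2 S hk) (P.toL2_injective S hk)
  refine ⟨core, bergmanModule S k hR, ?_⟩
  let : NormedAddCommGroup (bergmanSpace (n := n) S k) := core.toNormedAddCommGroup
  let : InnerProductSpace ℂ (bergmanSpace (n := n) S k) := .ofCore core.toCore
  let := bergmanModule S k hR
  have norm_toL2_eq (α : bergmanSpace (n := n) S k) : ‖P.toL2 S hk α‖ = ‖α‖ := by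
    rw [norm_eq_sqrt_re_inner (𝕜 := ℂ) α, norm_eq_sqrt_re_inner (𝕜 := ℂ) (P.toL2 S hk α)]
    rfl
  have norm_eq (α : bergmanSpace (n := n) S k) :
      ‖α‖ = √(weightedNormSq S k (α : FormField n Ω E)).toReal :=
    (norm_toL2_eq α).symm.trans (P.norm_toL2 S hk α)
  have := completeSpace_of_isClosed_range (P.toL2 S hk) norm_toL2_eq (P.isClosed_range_toL2 S hk)
  have hι : IsBergmanEmbedding S k (bergmanSpace (n := n) S k).subtype := ⟨Subtype.prop, norm_eq⟩
  exact ⟨fun α => by rw [norm_eq, Real.sq_sqrt ENNReal.toReal_nonneg],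
    hι.isAnalyticHilbertModuleOfForms hk hR fun _ _ => rfl,
    hι.exists_beurlingCharacterization hk hR (fun _ _ => rfl) p⟩

theorem theorem7p5 (n : ℕ) (hn : 1 ≤ n)
    {E : Type*} [NormedAddCommGroup E] [InnerProductSpace ℂ E] [CompleteSpace E]
    (S : ConjInvolution E) :
    (∀ (Ω : Type*) [TopologicalSpace Ω] [T2Space Ω] [ParacompactSpace Ω] [ConnectedSpace Ω]
        [ChartedSpace (Fin n → ℂ) Ω] [IsManifold 𝓘(ℂ, Fin n → ℂ) ω Ω]
        [MeasurableSpace Ω] [BorelSpace Ω] (p : Ω) (k : Ω → ℝ),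
      IsAdmissibleWeight n k →
        BergmanSpaceIsBeurlingModule (n := n) S k p (boundedAnalytic n Ω)) ∧
    (∀ (Ω : TopologicalSpace.Opens (Fin n → ℂ)), IsConnected (Ω : Set (Fin n → ℂ)) →
      Bornology.IsBounded (Ω : Set (Fin n → ℂ)) → ∀ (p : Ω) (k : Ω → ℝ),
      IsAdmissibleWeight n k →
        BergmanSpaceIsBeurlingModule (n := n) S k p (polynomialAlgebraOn Ω)) := by
  refine ⟨fun Ω _ _ _ _ _ _ _ _ p k hk => ?_, fun Ω hΩ hb p k hk => ?_⟩
  · have := ChartedSpace.locallyCompactSpace (Fin n → ℂ) Ω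
    have := sigmaCompactSpace_of_paracompact_of_connected Ω
    exact theorem7p5_general S p hk le_rfl
  · have := isConnected_iff_connectedSpace.1 hΩ
    have : LocallyCompactSpace Ω := Ω.isOpen.locallyCompactSpace
    exact theorem7p5_general S p hk (polynomialAlgebraOn_le_boundedAnalytic hb)
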